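/- Let $d\ge 1$ and let $\Omega\subset\mathbb R^d$ be compact, equal to the closure of its interior, and such that $D=\operatorname{int}(\Omega)$ is uniformly locally quasiconvex: there are $r>0$ and $C\ge 1$ such that any $x,y\in D$ with $|y-x|\le r$ are joined by a curve $\gamma\colon[0,1]\to D$ with Lipschitz constant at most $C|y-x|$. Let $\alpha>0$. **Spaces.** Let $\mathcal M(\Omega)=C(\Omega)^*$ with the dual norm $\|\cdot\|_{\mathcal M}$. Let $C^1(\Omega)$ be the space of all $\varphi\in C(\Omega)$ that are continuously differentiable in $\operatorname{int}(\Omega)$ and whose gradient extends continuously to $\Omega$, with the norm $\max\{\|\varphi\|_\infty,\|\nabla\varphi\|_\infty\}$ (Euclidean norm on $\mathbb R^d$). For $u\in\mathcal M(\Omega)$ and $v\in\mathcal M(\Omega;\mathbb R^d)=C(\Omega;\mathbb R^d)^*$ let $[u,v]\in C^1(\Omega)^*$ denote the functional $\varphi\mapsto\langle\varphi,u\rangle+\langle\nabla\varphi,v\rangle$. Define $G\colon C^1(\Omega)^*\to[0,\infty]$ by $G(h)=\alpha\|u\|_{\mathcal M}$ if $h=[u,0]$ for some (then unique) $u\in\mathcal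 M(\Omega)$, and $G(h)=\infty$ otherwise. **Second subderivative.** For $\xi\in C^1(\Omega)^*$ with $G(\xi)<\infty$, $p\in C^1(\Omega)$, $t>0$ and $h\in C^1(\Omega)^*$ put $$Q_t(h)=\frac{G(\xi+t h)-G(\xi)-t\langle p,h\rangle}{t^2/2},\qquad G''(\xi,p;h)=\inf\Big\{\liminf_{k\to\infty}Q_{t_k}(h_k)\ :\ t_k\searrow0,\ h_k\rightharpoonup^* h\Big\}.$$ $G$ is called (strictly) twice weak* epi-differentiable at $\xi$ for $p$ if for every $h\in C^1(\Omega)^*$ and every sequence $t_k\searrow0$ of positive numbers there are $h_k\rightharpoonup^* h$ with $\|h_k\|\to\|h\|$ and $Q_{t_k}(h_k)\to G''(\xi,p;h)$. **Data.** Let $\bar u=\sum_{j=1}^N\bar\lambda_j\delta_{\bar x_j}$ with pairwise distinct $\bar x_j\in\operatorname{int}(\Omega)$ and $\bar\lambda_j\ne0$ for all $j$. Let $\bar p\in C^1(\Omega)$ belong to the convex subdifferential of $\alpha\|\cdot\|_{\mathcal M}$ at $\bar u$, and let $\bar p$ be twice differentiable at every $\bar x_j$. Put $\mathcal A=\{\bar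 x_1,\dots,\bar x_N\}$ and $\mathcal I_\pm=\{x\in\Omega:\bar p(x)=\pm\alpha\}\setminus\mathcal A$. **Theorem.** Assume the curvature condition: there is $\theta>0$ with $\operatorname{sgn}(\bar p(\bar x_j))\,v^\top\nabla^2\bar p(\bar x_j)v\le-\theta|v|^2$ for all $v\in\mathbb R^d$ and $j=1,\dots,N$. Then $G$ is (strictly) twice weak* epi-differentiable at $[\bar u,0]$ for $\bar p$. Moreover, for all $c_j\in\mathbb R$, $V_j\in\mathbb R^d$ ($j=1,\dots,N$), every finite nonnegative Borel measure $\mu_+$ concentrated on $\mathcal I_+$ and every finite nonpositive Borel measure $\mu_-$ concentrated on $\mathcal I_-$, $$G''\Big([\bar u,0],\bar p;\Big[\sum_{j=1}^N c_j\delta_{\bar x_j}+\mu_++\mu_-,\ \sum_{j=1}^N V_j\delta_{\bar x_j}\Big]\Big)=-\sum_{j=1}^N\frac1{\bar\lambda_j}V_j^\top\nabla^2\bar p(\bar x_j)V_j,$$ and $G''([\bar u,0],\bar p;h)=+\infty$ for every $h\in C^1(\Omega)^*$ that is not of this form. -/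

import Mathlib

open Filter Topology MeasureTheory TopologicalSpace
open scoped NNReal

noncomputable section

namespace SparseLift

/-! ### Generalized second derivatives on a dual space -/

/-- The dual space of a normed space (Mathlib's `StrongDual`, with its operator norm). -/
abbrev NormedDual (Z : Type*) [NormedAddCommGroup Z] [NormedSpace ℝ Z] : Type _ :=
  StrongDual ℝ Z

section Abstract

variable {Z : Type*} [NormedAddCommGroup Z] [NormedSpace ℝ Z]

/-- Sequential weak* convergence in the dual of `Z`. -/
def WeakStarTendsto (h : ℕ → NormedDual Z) (h₀ : NormedDual Z) : Prop :=
  Tendsto (fun k => StrongDual.toWeakDual (h k)) atTop (𝓝 (StrongDual.toWeakDual h₀))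

/-- The second-order difference quotient
`(G (x + t h) - G x - t ⟨p, h⟩) / (t² / 2)`, with values in the extended reals. -/
def secondQuotient (G : NormedDual Z → EReal) (x : NormedDual Z) (p : Z)
    (t : ℝ) (h : NormedDual Z) : EReal :=
  (G (x + t • h) - G x - ((t * h p : ℝ) : EReal)) / ((t ^ 2 / 2 : ℝ) : EReal)

/-- The weak* second subderivative `G''(x, p; h)`: the infimum of the lower limits of the
second-order difference quotients over all `t k ↘ 0` and all `h k` converging weakly* to `h`. -/
def weakStarSecondSubderiv (G : NormedDual Z → EReal) (x : NormedDual Z) (p : Z)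
    (h : NormedDual Z) : EReal :=
  sInf {a : EReal | ∃ (t : ℕ → ℝ) (hs : ℕ → NormedDual Z),
    (∀ k, 0 < t k) ∧ Tendsto t atTop (𝓝 0) ∧ WeakStarTendsto hs h ∧
    a = liminf (fun k => secondQuotient G x p (t k) (hs k)) atTop}

/-- (Strict) twice weak* epi-differentiability of `G` at `x` for `p`: for every direction `h` and
every sequence `t k ↘ 0` there is a recovery sequence `h k` converging weakly* to `h`, with
convergence of the norms, along which the difference quotients converge to `G''(x, p; h)`. -/
def IsTwiceWeakStarEpiDifferentiable (G : NormedDual Z → EReal) (x : NormedDual Z)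
    (p : Z) : Prop :=
  ∀ (h : NormedDual Z) (t : ℕ → ℝ), (∀ k, 0 < t k) → Tendsto t atTop (𝓝 0) →
    ∃ hs : ℕ → NormedDual Z, WeakStarTendsto hs h ∧
      Tendsto (fun k => ‖hs k‖) atTop (𝓝 ‖h‖) ∧
      Tendsto (fun k => secondQuotient G x p (t k) (hs k)) atTop
        (𝓝 (weakStarSecondSubderiv G x p h))

/-- `z ∈ Z` is a subgradient at `u` of the real-valued function `f` on the dual of `Z`. -/
def IsSubgradientAt (f : NormedDual Z → ℝ) (u : NormedDual Z) (z : Z) : Prop :=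
  ∀ v : NormedDual Z, f u + (v - u) z ≤ f v

end Abstract

/-- A set `D` is uniformly locally quasiconvex: for some `r > 0` and `C ≥ 1`, any two points
`x, y ∈ D` with `|y - x| ≤ r` are joined by a curve in `D`, defined on `[0, 1]`, with Lipschitz
constant at most `C |y - x|`. -/
def UniformlyLocallyQuasiconvex {d : ℕ} (D : Set (EuclideanSpace ℝ (Fin d))) : Prop :=
  ∃ (r : ℝ) (C : ℝ≥0), 0 < r ∧ 1 ≤ C ∧ ∀ x ∈ D, ∀ y ∈ D, dist x y ≤ r →
    ∃ γ : ℝ → EuclideanSpace ℝ (Fin d), γ 0 = x ∧ γ 1 = y ∧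
      Set.MapsTo γ (Set.Icc 0 1) D ∧ LipschitzOnWith (C * nndist x y) γ (Set.Icc 0 1)

/-! ### The spaces `C(Ω)`, `M(Ω)`, `C¹(Ω)` and `C¹(Ω)*` -/

section Spaces

variable {d : ℕ}

/-- The space of Radon measures on the compact set `Ω`: the dual of `C(Ω)`, with the dual norm. -/
abbrev RadonMeasure (Ω : Compacts (EuclideanSpace ℝ (Fin d))) : Type :=
  NormedDual C(Ω, ℝ)

/-- The space of `ℝᵈ`-valued Radon measures on `Ω`: the dual of `C(Ω; ℝᵈ)`. -/
abbrev VectorRadonMeasure (Ω : Compacts (EuclideanSpace ℝ (Fin d))) : Type :=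
  NormedDual C(Ω, EuclideanSpace ℝ (Fin d))

/-- Extension by zero of a function on `Ω` to the whole space; only its values on `Ω`, and its
derivatives at interior points of `Ω`, are used. -/
def extendZero {Ω : Compacts (EuclideanSpace ℝ (Fin d))} (φ : Ω → ℝ) :
    EuclideanSpace ℝ (Fin d) → ℝ :=
  Function.extend Subtype.val φ 0

/-- The space `C¹(Ω)`, as the space of pairs `(φ, ∇φ) ∈ C(Ω) × C(Ω; ℝᵈ)`: the continuous function
`φ` is differentiable in the interior of `Ω`, and its gradient there is the restriction of the
second component (which `φ` determines if `Ω` is the closure of its interior). The norm inherited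
from the product is the maximum of the sup-norms of `φ` and `∇φ`. -/
def C1 (Ω : Compacts (EuclideanSpace ℝ (Fin d))) :
    Submodule ℝ (C(Ω, ℝ) × C(Ω, EuclideanSpace ℝ (Fin d))) where
  carrier := {f | ∀ x : Ω, (x : EuclideanSpace ℝ (Fin d)) ∈
    interior (Ω : Set (EuclideanSpace ℝ (Fin d))) → HasGradientAt (extendZero f.1) (f.2 x) x}
  zero_mem' := by
    intro x _
    have h : extendZero (Ω := Ω) ((0 : C(Ω, ℝ)) : Ω → ℝ) = fun _ => 0 := by
      funext y
      by_cases hy : ∃ a : Ω, a.1 = y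
      · obtain ⟨a, rfl⟩ := hy
        exact Subtype.val_injective.extend_apply _ _ _
      · exact Function.extend_apply' _ _ _ hy
    change HasGradientAt (extendZero (Ω := Ω) ((0 : C(Ω, ℝ)) : Ω → ℝ)) 0 x.1
    rw [h]
    exact hasGradientAt_const x.1 (0 : ℝ)
  add_mem' := by
    intro f g hf hg x hx
    have h : extendZero (Ω := Ω) ((f + g).1 : Ω → ℝ)
        = fun y => extendZero f.1 y + extendZero g.1 y := by
      funext y
      by_cases hy : ∃ a : Ω, a.1 = y
      · obtain ⟨a, rfl⟩ := hy
        simp [extendZero]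
      · simp [extendZero, Function.extend_apply' _ _ _ hy]
    have := (hf x hx).hasFDerivAt.add (hg x hx).hasFDerivAt
    rw [hasGradientAt_iff_hasFDerivAt, h]
    exact this.congr_fderiv (map_add _ _ _).symm
  smul_mem' := by
    intro c f hf x hx
    have h : extendZero (Ω := Ω) ((c • f).1 : Ω → ℝ) = fun y => c • extendZero f.1 y := by
      funext y
      by_cases hy : ∃ a : Ω, a.1 = y
      · obtain ⟨a, rfl⟩ := hy
        simp [extendZero]
      · simp [extendZero, Function.extend_apply' _ _ _ hy]
    have := (hf x hx).hasFDerivAt.const_smul c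
    rw [hasGradientAt_iff_hasFDerivAt, h]
    refine this.congr_fderiv ?_
    change c • _ = InnerProductSpace.toDual ℝ (EuclideanSpace ℝ (Fin d)) (c • f.2 x)
    rw [map_smulₛₗ]
    rfl

variable {Ω : Compacts (EuclideanSpace ℝ (Fin d))}

/-- The functional `[u, v] : φ ↦ ⟨φ, u⟩ + ⟨∇φ, v⟩` on `C¹(Ω)`. -/
def lift (u : RadonMeasure Ω) (v : VectorRadonMeasure Ω) : NormedDual (C1 Ω) :=
  (u.coprod v).comp (C1 Ω).subtypeL

/-- The canonical map `Π : M(Ω) → C¹(Ω)*`, `Π u = [u, 0]`. -/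
def embed (u : RadonMeasure Ω) : NormedDual (C1 Ω) :=
  lift u 0

/-- The lifted Radon-norm functional: `G h = α ‖u‖` if `h = Π u` for some Radon measure `u`
(which is then unique, so that the infimum runs over one element), and `G h = ∞` otherwise. -/
def liftedNorm (α : ℝ) (h : NormedDual (C1 Ω)) : EReal :=
  ⨅ (u : RadonMeasure Ω) (_ : embed u = h), ((α * ‖u‖ : ℝ) : EReal)

/-- The Dirac measure at `x`. -/
def dirac (x : Ω) : RadonMeasure Ω :=
  ContinuousMap.evalCLM ℝ x

/-- The vector-valued Dirac measure `V δ_x`. -/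
def vectorDirac (x : Ω) (V : EuclideanSpace ℝ (Fin d)) : VectorRadonMeasure Ω :=
  (innerSL ℝ V).comp (ContinuousMap.evalCLM ℝ x)

/-- The element of `M(Ω)` given by a finite positive Borel measure, `φ ↦ ∫ φ dμ`. -/
def ofMeasure (μ : Measure Ω) [IsFiniteMeasure μ] : RadonMeasure Ω :=
  LinearMap.mkContinuous
    { toFun := fun φ => ∫ y, φ y ∂μ
      map_add' := fun φ ψ => integral_add
        (BoundedContinuousFunction.integrable μ (BoundedContinuousFunction.mkOfCompact φ))
        (BoundedContinuousFunction.integrable μ (BoundedContinuousFunction.mkOfCompact ψ))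
      map_smul' := fun c φ => integral_const_mul c φ }
    (μ.real Set.univ)
    (fun φ => by
      have := norm_integral_le_of_norm_le_const (μ := μ)
        (Eventually.of_forall fun y => φ.norm_coe_le_norm y)
      simpa [mul_comm] using this)

/-- The contact set `{p = c}` without the points `x j`: for `c = ± α`, the sets `ℐ_±`. -/
def contactSet {N : ℕ} (p : C1 Ω) (x : Fin N → Ω) (c : ℝ) : Set Ω :=
  {y | p.1.1 y = c} \ Set.range x

/-- The Hessian `∇²p(x)` as a bilinear map, used at interior points `x` of `Ω`. -/
def hessian (p : C1 Ω) (x : Ω) :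
    EuclideanSpace ℝ (Fin d) →L[ℝ] EuclideanSpace ℝ (Fin d) →L[ℝ] ℝ :=
  fderiv ℝ (fderiv ℝ (extendZero p.1.1)) x

/-- The direction `[∑ c_j δ_{x_j} + μ_+ + μ_-, ∑ V_j δ_{x_j}]` in `C¹(Ω)*`, where `μ_+ = μ` and
`μ_- = -ν` for finite positive measures `μ` and `ν`. -/
def direction {N : ℕ} (x : Fin N → Ω) (c : Fin N → ℝ) (V : Fin N → EuclideanSpace ℝ (Fin d))
    (μ ν : Measure Ω) [IsFiniteMeasure μ] [IsFiniteMeasure ν] : NormedDual (C1 Ω) :=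
  lift ((∑ j, c j • dirac (x j)) + ofMeasure μ + -ofMeasure ν) (∑ j, vectorDirac (x j) (V j))

end Spaces

end SparseLift

end

/-! Write `σ_j = sgn l_j`. The subgradient property gives `⟨p, u⟩ = α‖u‖`, so if `u + t h` is a
measure `w`, its difference quotient is `(α‖w‖ - ⟨p, w⟩) / (t²/2)`: everything concerns the size of
a duality gap. A gap `ε` is exploited by testing: if `|p + g| ≤ α + δ` on `Ω`, then `⟨g, w⟩ ≤ ε +
δ‖w‖` (`IsSparsePair.apply_le_of_gap`). Well-chosen `g` replace any decomposition of `w` itself. The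
room for `g` near `x_j` is the quadratic growth of `α - σ_j p` provided by the curvature condition
(`IsSparsePair.exists_growth`).

Shape of the directions. Suppose the quotients stay below `M` along a sequence. Cutoffs `χ_j` around
the `x_j` split the limit `h`. Near `x_j`, functions vanishing to first order are annihilated
(`apply_bump_mul_eq_zero`), so `h(χ_j f)` depends only on `f(x_j)` and `∇f(x_j)`. Away from the
points, `h` is nonpositive on all `g` with `|p + g| ≤ α`; multiplying by `α ± p` turns this into two
positive functionals, which are measures on the contact sets (`exists_contact_measure`). Every other
`h` therefore has second subderivative `∞`.

Lower bound. With `A_j = -σ_j ∇²p(x_j)` and `D_j = V_j / l_j`, the quadratic `A_j(z,z)/2` lies above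
its tangent at `t D_j`. These tangents, with a factor `β < 1` and cut off, are admissible test
functions. Dividing by `t²`, letting `t → 0` and then `β → 1` gives the formula as a lower bound
(`mul_le_of_direction`).

Recovery. Move the masses: `∑ (l_j + s c_j) δ_{x_j + s D_j} + s(μ - ν)`. The gap is computed by
Taylor expansion of `p` at `x_j` and attains the bound (`tendsto_gap_bound`). For the norms, each
`f` is compared with its composition with a deformation of `Ω` that shifts the points `x_j`
(`exists_norm_quotient_le`); weak* lower semicontinuity gives the other inequality. -/

noncomputable section

namespace SparseLift

/-! ### Functions in `C1 Ω`, cutoffs, and the pairing with functionals -/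

section C1Functions

variable {d : ℕ} {Ω : Compacts (EuclideanSpace ℝ (Fin d))}

local notation "E" => EuclideanSpace ℝ (Fin d)

theorem extendZero_coe (φ : Ω → ℝ) (y : Ω) : extendZero φ y = φ y :=
  Subtype.val_injective.extend_apply _ _ _

theorem mem_nhds_of_mem_interior {x : E} (hx : x ∈ interior (Ω : Set E)) :
    (Ω : Set E) ∈ 𝓝 x :=
  mem_interior_iff_mem_nhds.1 hx

theorem extendZero_eventuallyEq {φ : Ω → ℝ} {g : E → ℝ} (h : ∀ y : Ω, φ y = g y) {x : E}
    (hx : x ∈ interior (Ω : Set E)) : extendZero φ =ᶠ[𝓝 x] g := by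
  filter_upwards [mem_nhds_of_mem_interior hx] with y hy
  rw [← h ⟨y, hy⟩, ← extendZero_coe φ ⟨y, hy⟩]

theorem C1.hasGradientAt (f : C1 Ω) {x : Ω} (hx : (x : E) ∈ interior (Ω : Set E)) :
    HasGradientAt (extendZero f.1.1) (f.1.2 x) x :=
  f.2 x hx

/-- The restriction to `Ω` of a continuously differentiable function on the whole space. -/
def C1.ofContDiff (g : E → ℝ) (hg : ContDiff ℝ 1 g) : C1 Ω :=
  ⟨(⟨fun y => g y, hg.continuous.comp continuous_subtype_val⟩,
    ⟨fun y => gradient g y, ((InnerProductSpace.toDual ℝ E).symm.continuous.comp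
      (hg.continuous_fderiv one_ne_zero)).comp continuous_subtype_val⟩), fun x hx => by
    have h1 : HasGradientAt g (gradient g x) x :=
      (hg.differentiable one_ne_zero x).hasGradientAt
    exact h1.congr_of_eventuallyEq (extendZero_eventuallyEq (fun y => rfl) hx)⟩

/-- Multiplication by a `C¹` function, as a linear map on `C¹(Ω)`. -/
def C1.mul (f : C1 Ω) : C1 Ω →ₗ[ℝ] C1 Ω where
  toFun g := ⟨(f.1.1 * g.1.1, f.1.1 • g.1.2 + g.1.1 • f.1.2), fun x hx => by
    have h1 := (C1.hasGradientAt f hx).hasFDerivAt.mul (C1.hasGradientAt g hx).hasFDerivAt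
    rw [hasGradientAt_iff_hasFDerivAt]
    refine (h1.congr_of_eventuallyEq (extendZero_eventuallyEq (fun y => ?_) hx)).congr_fderiv ?_
    · simp [extendZero_coe]
    · ext v
      simp [extendZero_coe]⟩
  map_add' g g' := by
    refine Subtype.ext (Prod.ext ?_ ?_)
    · exact mul_add _ _ _
    · ext1 y
      change f.1.1 y • (g.1.2 y + g'.1.2 y) + (g.1.1 y + g'.1.1 y) • f.1.2 y
        = (f.1.1 y • g.1.2 y + g.1.1 y • f.1.2 y) + (f.1.1 y • g'.1.2 y + g'.1.1 y • f.1.2 y)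
      module
  map_smul' c g := by
    refine Subtype.ext (Prod.ext ?_ ?_)
    · exact mul_smul_comm _ _ _
    · ext1 y
      change f.1.1 y • (c • g.1.2 y) + (c * g.1.1 y) • f.1.2 y
        = c • (f.1.1 y • g.1.2 y + g.1.1 y • f.1.2 y)
      module

@[simp] theorem C1.mul_fst (f g : C1 Ω) (y : Ω) :
    (C1.mul f g).1.1 y = f.1.1 y * g.1.1 y := rfl

@[simp] theorem C1.mul_snd (f g : C1 Ω) (y : Ω) :
    (C1.mul f g).1.2 y = f.1.1 y • g.1.2 y + g.1.1 y • f.1.2 y := rfl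

/-- The constant function `1`. -/
def C1.one : C1 Ω := C1.ofContDiff (fun _ => 1) contDiff_const

@[simp] theorem C1.one_fst (y : Ω) : (C1.one : C1 Ω).1.1 y = 1 := rfl

@[simp] theorem C1.one_snd (y : Ω) : (C1.one : C1 Ω).1.2 y = 0 := by
  change gradient (fun _ : E => (1 : ℝ)) y = 0
  simp [gradient]

/-- The affine function `y ↦ ⟨v, y - x⟩`. -/
def C1.affine (x : E) (v : E) : C1 Ω :=
  ⟨(⟨fun y => inner ℝ v (y - x : E), by fun_prop⟩, ContinuousMap.const _ v), fun y hy => by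
    have h1 : HasGradientAt (fun y : E => inner ℝ v (y - x)) v y := by
      rw [hasGradientAt_iff_hasFDerivAt]
      refine ((innerSL ℝ v).hasFDerivAt.comp (y : E)
        ((hasFDerivAt_id (y : E)).sub_const x)).congr_fderiv ?_
      ext w
      simp
    exact h1.congr_of_eventuallyEq (extendZero_eventuallyEq
      (g := fun y : E => inner ℝ v (y - x)) (fun y => rfl) hy)⟩

@[simp] theorem C1.affine_fst (x v : E) (y : Ω) :
    (C1.affine x v : C1 Ω).1.1 y = inner ℝ v (y - x : E) := rfl

@[simp] theorem C1.affine_snd (x v : E) (y : Ω) : (C1.affine x v : C1 Ω).1.2 y = v := rfl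

/-- Smooth cutoff at `x`, equal to `1` on the ball of radius `r / 2` and supported in the ball of
radius `r`. -/
def bump (x : E) (r : ℝ) (hr : 0 < r) : ContDiffBump x := ⟨r / 2, r, by linarith, by linarith⟩

/-- The restriction of the smooth cutoff `bump` to `Ω`. -/
def C1.bump (x : E) (r : ℝ) (hr : 0 < r) : C1 Ω :=
  C1.ofContDiff (SparseLift.bump x r hr) (SparseLift.bump x r hr).contDiff

theorem C1.bump_nonneg (x : E) (r : ℝ) (hr : 0 < r) (y : Ω) :
    0 ≤ (C1.bump x r hr : C1 Ω).1.1 y := (SparseLift.bump x r hr).nonneg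

theorem C1.bump_le_one (x : E) (r : ℝ) (hr : 0 < r) (y : Ω) :
    (C1.bump x r hr : C1 Ω).1.1 y ≤ 1 := (SparseLift.bump x r hr).le_one

theorem C1.bump_eq_one {x : E} {r : ℝ} {hr : 0 < r} {y : Ω} (h : dist (y : E) x ≤ r / 2) :
    (C1.bump x r hr : C1 Ω).1.1 y = 1 :=
  (SparseLift.bump x r hr).one_of_mem_closedBall h

theorem C1.bump_eq_zero {x : E} {r : ℝ} {hr : 0 < r} {y : Ω} (h : r ≤ dist (y : E) x) :
    (C1.bump x r hr : C1 Ω).1.1 y = 0 :=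
  (SparseLift.bump x r hr).zero_of_le_dist h

theorem C1.dist_lt_of_bump_ne_zero {x : E} {r : ℝ} {hr : 0 < r} {y : Ω}
    (h : (C1.bump x r hr : C1 Ω).1.1 y ≠ 0) : dist (y : E) x < r := by
  by_contra! hc
  exact h (C1.bump_eq_zero hc)

theorem gradient_bump_self (x : E) (r : ℝ) (hr : 0 < r) : gradient (bump x r hr) x = 0 := by
  have h : (bump x r hr : E → ℝ) =ᶠ[𝓝 x] fun _ => 1 := (bump x r hr).eventuallyEq_one
  have := h.fderiv_eq (𝕜 := ℝ)
  simp [gradient, this]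

theorem gradient_bump_of_lt {x y : E} {r : ℝ} {hr : 0 < r} (h : r < dist y x) :
    gradient (bump x r hr) y = 0 := by
  have h : (bump x r hr : E → ℝ) =ᶠ[𝓝 y] fun _ => 0 := by
    filter_upwards [(continuous_id.dist continuous_const).continuousAt.eventually
      (lt_mem_nhds h)] with z hz
    exact (bump x r hr).zero_of_le_dist (le_of_lt hz)
  have := h.fderiv_eq (𝕜 := ℝ)
  simp [gradient, this]

theorem C1.bump_snd (x : E) (r : ℝ) (hr : 0 < r) (y : Ω) :
    (C1.bump x r hr : C1 Ω).1.2 y = gradient (SparseLift.bump x r hr) y := rfl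

theorem abs_apply_le_norm (f : C1 Ω) (y : Ω) : |f.1.1 y| ≤ ‖f‖ :=
  (f.1.1.norm_coe_le_norm y).trans (le_max_left _ _)

theorem norm_snd_apply_le_norm (f : C1 Ω) (y : Ω) : ‖f.1.2 y‖ ≤ ‖f‖ :=
  (f.1.2.norm_coe_le_norm y).trans (le_max_right _ _)

@[simp] theorem lift_apply (u : RadonMeasure Ω) (v : VectorRadonMeasure Ω) (f : C1 Ω) :
    lift u v f = u f.1.1 + v f.1.2 := rfl

@[simp] theorem embed_apply (u : RadonMeasure Ω) (f : C1 Ω) : embed u f = u f.1.1 := by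
  simp [embed]

@[simp] theorem dirac_apply (x : Ω) (f : C(Ω, ℝ)) : dirac x f = f x := rfl

@[simp] theorem vectorDirac_apply (x : Ω) (V : E) (f : C(Ω, E)) :
    vectorDirac x V f = inner ℝ V (f x) := rfl

@[simp] theorem ofMeasure_apply (μ : Measure Ω) [IsFiniteMeasure μ] (f : C(Ω, ℝ)) :
    ofMeasure μ f = ∫ y, f y ∂μ := rfl

theorem direction_apply {N : ℕ} (x : Fin N → Ω) (c : Fin N → ℝ) (V : Fin N → E)
    (μ ν : Measure Ω) [IsFiniteMeasure μ] [IsFiniteMeasure ν] (f : C1 Ω) :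
    direction x c V μ ν f = (∑ j, (c j * f.1.1 (x j) + inner ℝ (V j) (f.1.2 (x j))))
      + ∫ y, f.1.1 y ∂μ - ∫ y, f.1.1 y ∂ν := by
  simp [direction, Finset.sum_add_distrib]
  ring

theorem norm_dirac_le (x : Ω) : ‖(dirac x : RadonMeasure Ω)‖ ≤ 1 :=
  ContinuousLinearMap.opNorm_le_bound _ zero_le_one fun f => by
    simpa using f.norm_coe_le_norm x

theorem norm_ofMeasure_le (μ : Measure Ω) [IsFiniteMeasure μ] :
    ‖ofMeasure μ‖ ≤ μ.real Set.univ :=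
  LinearMap.mkContinuous_norm_le _ measureReal_nonneg _

theorem weakStarTendsto_iff {Z : Type*} [NormedAddCommGroup Z] [NormedSpace ℝ Z]
    {h : ℕ → NormedDual Z} {h₀ : NormedDual Z} :
    WeakStarTendsto h h₀ ↔ ∀ z, Tendsto (fun k => h k z) atTop (𝓝 (h₀ z)) := by
  unfold WeakStarTendsto
  rw [tendsto_iff_forall_eval_tendsto_topDualPairing]
  rfl

end C1Functions

/-- Along the segment, `s ↦ P (x + s z) - s² H(z,z)/2` has derivative `(DP(x + s z) - H(s z)) z`.
Differentiability of `DP` at the single point `x` makes this at most `η‖z‖²`, and the mean value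
inequality concludes. -/
theorem exists_quadratic_expansion {F : Type*} [NormedAddCommGroup F] [NormedSpace ℝ F]
    {P : F → ℝ} {x : F} (hP : ∀ᶠ y in 𝓝 x, DifferentiableAt ℝ P y)
    (hP2 : DifferentiableAt ℝ (fderiv ℝ P) x) (h0 : fderiv ℝ P x = 0) {η : ℝ} (hη : 0 < η) :
    ∃ ρ > 0, ∀ z : F, ‖z‖ < ρ →
      |P (x + z) - P x - fderiv ℝ (fderiv ℝ P) x z z / 2| ≤ η * ‖z‖ ^ 2 := by
  have h1 := hP2.hasFDerivAt.isLittleO.def hη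
  obtain ⟨ρ, hρ, hb⟩ := Metric.eventually_nhds_iff_ball.1 (hP.and h1)
  refine ⟨ρ, hρ, fun z hz => ?_⟩
  set H := fderiv ℝ (fderiv ℝ P) x
  have hmem : ∀ s ∈ Set.Icc (0 : ℝ) 1, x + s • z ∈ Metric.ball x ρ := fun s hs => by
    rw [mem_ball_iff_norm, add_sub_cancel_left, norm_smul, Real.norm_of_nonneg hs.1]
    nlinarith [norm_nonneg z, hs.2]
  have hder : ∀ s ∈ Set.Icc (0 : ℝ) 1, HasDerivWithinAt
      (fun s : ℝ => P (x + s • z) - s ^ 2 * (H z z / 2))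
      (fderiv ℝ P (x + s • z) z - s * H z z) (Set.Icc 0 1) s := fun s hs => by
    have h2 : HasDerivAt (fun s : ℝ => x + s • z) z s := by
      simpa using ((hasDerivAt_id s).smul_const z).const_add x
    have h3 := ((hb _ (hmem s hs)).1.hasFDerivAt.comp_hasDerivAt s h2)
    have h4 := ((hasDerivAt_id s).pow 2).mul_const (H z z / 2)
    refine ((h3.sub h4).congr_deriv ?_).hasDerivWithinAt
    simp
    ring
  have := norm_image_sub_le_of_norm_deriv_le_segment_01' hder (C := η * ‖z‖ ^ 2) fun s hs => ?_
  · simpa [sub_right_comm] using this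
  · have h5 := (hb _ (hmem s ⟨hs.1, hs.2.le⟩)).2
    rw [h0, sub_zero, add_sub_cancel_left] at h5
    have h6 := ContinuousLinearMap.le_opNorm (fderiv ℝ P (x + s • z) - H (s • z)) z
    have h7 : fderiv ℝ P (x + s • z) z - s * H z z
        = (fderiv ℝ P (x + s • z) - H (s • z)) z := by simp
    rw [h7]
    refine h6.trans ?_
    rw [norm_smul, Real.norm_of_nonneg hs.1] at h5
    have : ‖fderiv ℝ P (x + s • z) - H (s • z)‖ ≤ η * ‖z‖ := h5.trans (by
      have := mul_le_mul_of_nonneg_right hs.2.le (norm_nonneg z)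
      nlinarith)
    nlinarith [norm_nonneg z]

/-! ### Sparse measures, consequences of the subgradient inequality, quadratic growth -/

section SparsePair

variable {d : ℕ} {Ω : Compacts (EuclideanSpace ℝ (Fin d))} {N : ℕ}

local notation "E" => EuclideanSpace ℝ (Fin d)

/-- The sparse measure `∑ l_j δ_{x_j}`. -/
def sparse (l : Fin N → ℝ) (x : Fin N → Ω) : RadonMeasure Ω := ∑ j, l j • dirac (x j)

theorem sparse_apply (l : Fin N → ℝ) (x : Fin N → Ω) (f : C(Ω, ℝ)) :
    sparse l x f = ∑ j, l j * f (x j) := by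
  simp [sparse]

/-- Distinct points `x j` have distance at least `2 ρ`, so that the balls of radius `ρ` around them
are disjoint. -/
def Separated (x : Fin N → Ω) (ρ : ℝ) : Prop := ∀ i j, i ≠ j → 2 * ρ ≤ dist (x i : E) (x j)

theorem Separated.mono {x : Fin N → Ω} {ρ ρ' : ℝ} (h : Separated x ρ) (hρ : ρ' ≤ ρ) :
    Separated x ρ' := fun i j hij => by linarith [h i j hij]

theorem exists_separated {x : Fin N → Ω} (hx : Function.Injective x) :
    ∃ ρ > 0, Separated x ρ := by
  have h : ∀ q : Fin N × Fin N, ∃ ρ > 0, q.1 ≠ q.2 → 2 * ρ ≤ dist (x q.1 : E) (x q.2) := by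
    rintro ⟨i, j⟩
    by_cases hij : i = j
    · exact ⟨1, one_pos, fun h => (h hij).elim⟩
    · have h1 : 0 < dist (x i : E) (x j) :=
        dist_pos.2 fun h => hij (hx (Subtype.ext h))
      exact ⟨dist (x i : E) (x j) / 2, by positivity, fun _ => (mul_div_cancel₀ _ two_ne_zero).le⟩
  choose r hr hr' using h
  obtain ⟨ρ, hρ, hle⟩ : ∃ ρ > 0, ∀ q, ρ ≤ r q := by
    rcases isEmpty_or_nonempty (Fin N × Fin N) with he | he
    · exact ⟨1, one_pos, fun q => he.elim q⟩
    · obtain ⟨q, hq⟩ := Finite.exists_min r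
      exact ⟨r q, hr q, hq⟩
  exact ⟨ρ, hρ, fun i j hij => by linarith [hr' (i, j) hij, hle (i, j)]⟩

theorem exists_pos_le_of_finite {ι : Type*} [Finite ι] {Q : ι → ℝ → Prop}
    (h : ∀ i, ∃ ρ > 0, Q i ρ) (hQ : ∀ i ρ ρ', ρ' ≤ ρ → Q i ρ → Q i ρ') :
    ∃ ρ > 0, ∀ i, Q i ρ := by
  choose r hr hr' using h
  rcases isEmpty_or_nonempty ι with he | he
  · exact ⟨1, one_pos, fun q => he.elim q⟩
  · obtain ⟨q, hq⟩ := Finite.exists_min r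
    exact ⟨r q, hr q, fun i => hQ i _ _ (hq i) (hr' i)⟩

theorem Separated.bump_eq_zero {x : Fin N → Ω} {ρ : ℝ} (h : Separated x ρ) {hρ : 0 < ρ}
    {i j : Fin N} (hij : i ≠ j) {y : Ω} (hy : dist (y : E) (x j) ≤ ρ) :
    (C1.bump (x i : E) ρ hρ : C1 Ω).1.1 y = 0 := by
  refine C1.bump_eq_zero ?_
  have h1 := h i j hij
  have h2 := dist_triangle_left (x i : E) (x j) (y : E)
  linarith

theorem Separated.bump_apply_center {x : Fin N → Ω} {ρ : ℝ} (h : Separated x ρ) {hρ : 0 < ρ}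
    (i j : Fin N) :
    (C1.bump (x i : E) ρ hρ : C1 Ω).1.1 (x j) = if i = j then 1 else 0 := by
  split_ifs with hij
  · subst hij
    exact C1.bump_eq_one (by rw [dist_self]; positivity)
  · exact h.bump_eq_zero hij (by simpa using hρ.le)

theorem Separated.bump_snd_center {x : Fin N → Ω} {ρ : ℝ} (h : Separated x ρ) {hρ : 0 < ρ}
    (i j : Fin N) : (C1.bump (x i : E) ρ hρ : C1 Ω).1.2 (x j) = 0 := by
  rw [C1.bump_snd]
  by_cases hij : i = j
  · subst hij
    exact gradient_bump_self _ _ _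
  · refine gradient_bump_of_lt ?_
    have h1 := h j i (Ne.symm hij)
    linarith

/-- Among the cutoffs at separated centers, at most one is nonzero at a given point. -/
theorem Separated.sum_bump_cases {x : Fin N → Ω} {ρ : ℝ} (h : Separated x ρ) (hρ : 0 < ρ)
    (y : Ω) :
    (∀ a : Fin N → ℝ, ∑ j, (C1.bump (x j : E) ρ hρ : C1 Ω).1.1 y * a j = 0) ∨
    ∃ j, dist (y : E) (x j) < ρ ∧ ∀ a : Fin N → ℝ,
      ∑ i, (C1.bump (x i : E) ρ hρ : C1 Ω).1.1 y * a i
        = (C1.bump (x j : E) ρ hρ : C1 Ω).1.1 y * a j := by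
  by_cases hy : ∃ j, (C1.bump (x j : E) ρ hρ : C1 Ω).1.1 y ≠ 0
  · obtain ⟨j, hj⟩ := hy
    have hj' := C1.dist_lt_of_bump_ne_zero hj
    refine Or.inr ⟨j, hj', fun a => Finset.sum_eq_single j (fun i _ hij => ?_) (by simp)⟩
    rw [h.bump_eq_zero hij hj'.le, zero_mul]
  · push Not at hy
    exact Or.inl fun a => Finset.sum_eq_zero fun j _ => by rw [hy j, zero_mul]

/-- The sparse measure and its dual variable: the consequences of the subgradient inequality that
are used, together with the curvature condition. -/
structure IsSparsePair (α : ℝ) (l : Fin N → ℝ) (x : Fin N → Ω) (p : C1 Ω) : Prop where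
  pos : 0 < α
  ne_zero (j : Fin N) : l j ≠ 0
  injective : Function.Injective x
  mem_interior (j : Fin N) : (x j : E) ∈ interior (Ω : Set E)
  abs_le (y : Ω) : |p.1.1 y| ≤ α
  apply_center (j : Fin N) : p.1.1 (x j) = Real.sign (l j) * α
  norm_sparse : α * ‖sparse l x‖ = sparse l x p.1.1
  differentiableAt (j : Fin N) : DifferentiableAt ℝ (fderiv ℝ (extendZero p.1.1)) (x j)
  curvature : ∃ θ : ℝ, 0 < θ ∧ ∀ (j : Fin N) (v : E),
      θ * ‖v‖ ^ 2 ≤ -Real.sign (l j) * hessian p (x j) v v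

theorem sign_mul_sign {a : ℝ} (ha : a ≠ 0) : Real.sign a * Real.sign a = 1 := by
  rcases Real.sign_apply_eq_of_ne_zero a ha with h | h <;> simp [h]

theorem abs_sign {a : ℝ} (ha : a ≠ 0) : |Real.sign a| = 1 := by
  rcases Real.sign_apply_eq_of_ne_zero a ha with h | h <;> simp [h]

/-- Test with the sum of disjoint cutoffs weighted by the signs of `l j`, which has sup-norm at most
`1`. -/
theorem sum_abs_le_norm_sparse (l : Fin N → ℝ) {x : Fin N → Ω} (hx : Function.Injective x) :
    ∑ j, |l j| ≤ ‖sparse l x‖ := by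
  obtain ⟨ρ, hρ, hsep⟩ := exists_separated hx
  set g : C1 Ω := ∑ j, Real.sign (l j) • C1.bump (x j : E) ρ hρ with hg
  have hgy : ∀ y, g.1.1 y = ∑ j, (C1.bump (x j : E) ρ hρ : C1 Ω).1.1 y * Real.sign (l j) := by
    intro y
    simp only [hg, AddSubmonoidClass.coe_finsetSum, Prod.fst_sum, ContinuousMap.coe_sum,
      Finset.sum_apply]
    exact Finset.sum_congr rfl fun j _ => mul_comm _ _
  have hsign : ∀ a : ℝ, |Real.sign a| ≤ 1 := fun a => by
    rcases Real.sign_apply_eq a with h | h | h <;> simp [h]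
  have hgn : ‖g.1.1‖ ≤ 1 := by
    refine (ContinuousMap.norm_le _ zero_le_one).2 fun y => ?_
    rw [hgy, Real.norm_eq_abs]
    rcases hsep.sum_bump_cases hρ y with h | ⟨j, -, h⟩
    · rw [h]; simp
    · rw [h, abs_mul, abs_of_nonneg (C1.bump_nonneg _ _ _ _)]
      exact mul_le_one₀ (C1.bump_le_one _ _ _ _) (abs_nonneg _) (hsign _)
  have h1 : sparse l x g.1.1 = ∑ j, |l j| := by
    rw [sparse_apply]
    refine Finset.sum_congr rfl fun j _ => ?_
    rw [hgy]
    simp only [hsep.bump_apply_center, ite_mul, one_mul, zero_mul, Finset.sum_ite_eq',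
      Finset.mem_univ, if_true]
    rcases lt_trichotomy (l j) 0 with h | h | h
    · rw [Real.sign_of_neg h, abs_of_neg h]; ring
    · simp [h]
    · rw [Real.sign_of_pos h, abs_of_pos h]; ring
  rw [← h1]
  exact (le_abs_self _).trans ((ContinuousLinearMap.le_opNorm (sparse l x) g.1.1).trans
    (mul_le_of_le_one_right (norm_nonneg _) hgn))

/-- The competitors `0` and `2u` give `α‖u‖ = ⟨p, u⟩`; the competitors `u ± δ_y` give `|p(y)| ≤ α`.
Then `∑ (α|l_j| - l_j p(x_j))` is a sum of nonnegative terms that is not positive, so every term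
vanishes and `p(x_j) = σ_j α`. -/
theorem isSparsePair_of_isSubgradientAt {α : ℝ} (hα : 0 < α) {l : Fin N → ℝ}
    (hl : ∀ j, l j ≠ 0) {x : Fin N → Ω} (hx_inj : Function.Injective x)
    (hx_int : ∀ j, (x j : E) ∈ interior (Ω : Set E)) {p : C1 Ω}
    (hp : IsSubgradientAt (fun v : RadonMeasure Ω => α * ‖v‖) (sparse l x) p.1.1)
    (hp_diff : ∀ j, DifferentiableAt ℝ (fderiv ℝ (extendZero p.1.1)) (x j))
    (hp_curv : ∃ θ : ℝ, 0 < θ ∧ ∀ (j : Fin N) (v : E),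
      Real.sign (p.1.1 (x j)) * hessian p (x j) v v ≤ -θ * ‖v‖ ^ 2) :
    IsSparsePair α l x p := by
  set u := sparse l x with hu
  have hnorm : α * ‖u‖ = u p.1.1 := by
    have h1 := hp 0
    have h2 := hp (2 • u)
    have h3 : ‖2 • u‖ ≤ 2 * ‖u‖ := by simpa using norm_nsmul_le (n := 2) (a := u)
    simp only [sub_apply, zero_apply, norm_zero,
      smul_apply, nsmul_eq_mul, Nat.cast_ofNat, mul_zero] at h1 h2
    have h4 := mul_le_mul_of_nonneg_left h3 hα.le
    linarith
  have hle : ∀ y, |p.1.1 y| ≤ α := fun y => by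
    have key : ∀ s : ℝ, |s| ≤ 1 → s * p.1.1 y ≤ α := fun s hs => by
      have h1 := hp (u + s • dirac y)
      simp only [add_sub_cancel_left, smul_apply, dirac_apply,
        smul_eq_mul] at h1
      have h2 : ‖u + s • dirac y‖ ≤ ‖u‖ + 1 := (norm_add_le _ _).trans (by
        gcongr
        rw [norm_smul, Real.norm_eq_abs]
        exact mul_le_one₀ hs (norm_nonneg _) (norm_dirac_le y))
      have h3 := mul_le_mul_of_nonneg_left h2 hα.le
      linarith
    have h1 := key 1 (by simp)
    have h2 := key (-1) (by simp)
    exact abs_le.2 ⟨by linarith, by linarith⟩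
  have hsum : ∑ j, (α * |l j| - l j * p.1.1 (x j)) ≤ 0 := by
    rw [Finset.sum_sub_distrib, ← sparse_apply, ← Finset.mul_sum]
    have := mul_le_mul_of_nonneg_left (sum_abs_le_norm_sparse l hx_inj) hα.le
    linarith
  have hterm : ∀ j, 0 ≤ α * |l j| - l j * p.1.1 (x j) := fun j => by
    have h1 : l j * p.1.1 (x j) ≤ |l j| * |p.1.1 (x j)| := by
      rw [← abs_mul]; exact le_abs_self _
    have h2 := mul_le_mul_of_nonneg_left (hle (x j)) (abs_nonneg (l j))
    linarith
  have happ : ∀ j, p.1.1 (x j) = Real.sign (l j) * α := fun j => by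
    have h1 := (Finset.sum_eq_zero_iff_of_nonneg (fun j _ => hterm j)).1
      (le_antisymm hsum (Finset.sum_nonneg fun j _ => hterm j)) j (Finset.mem_univ j)
    rcases lt_or_gt_of_ne (hl j) with h | h
    · rw [Real.sign_of_neg h]
      rw [abs_of_neg h] at h1
      have : l j * (p.1.1 (x j) + α) = 0 := by linarith
      rcases mul_eq_zero.1 this with h' | h' <;> linarith
    · rw [Real.sign_of_pos h]
      rw [abs_of_pos h] at h1
      have : l j * (p.1.1 (x j) - α) = 0 := by linarith
      rcases mul_eq_zero.1 this with h' | h' <;> linarith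
  refine ⟨hα, hl, hx_inj, hx_int, hle, happ, hnorm, hp_diff, ?_⟩
  obtain ⟨θ, hθ, h⟩ := hp_curv
  refine ⟨θ, hθ, fun j v => ?_⟩
  have h1 := h j v
  have h2 : Real.sign (p.1.1 (x j)) = Real.sign (l j) := by
    rw [happ]
    rcases Real.sign_apply_eq_of_ne_zero _ (hl j) with h | h <;> rw [h]
    · rw [Real.sign_of_neg]; linarith
    · rw [Real.sign_of_pos]; linarith
  rw [h2] at h1
  linarith

namespace IsSparsePair

variable {α : ℝ} {l : Fin N → ℝ} {x : Fin N → Ω} {p : C1 Ω}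

theorem abs_sign_mul (hp : IsSparsePair α l x p) (j : Fin N) (a : ℝ) :
    |Real.sign (l j) * a| = |a| := by
  rw [abs_mul, abs_sign (hp.ne_zero j), one_mul]

theorem sign_mul_apply_center (hp : IsSparsePair α l x p) (j : Fin N) :
    Real.sign (l j) * p.1.1 (x j) = α := by
  rw [hp.apply_center, ← mul_assoc, sign_mul_sign (hp.ne_zero j), one_mul]

/-- Since `|p| ≤ α` and `p(x_j) = ±α`, the interior point `x_j` is a local extremum. -/
theorem fderiv_center (hp : IsSparsePair α l x p) (j : Fin N) :
    fderiv ℝ (extendZero p.1.1) (x j) = 0 := by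
  have hn := mem_nhds_of_mem_interior (hp.mem_interior j)
  have hle : ∀ᶠ y in 𝓝 (x j : E), |extendZero p.1.1 y| ≤ α := by
    filter_upwards [hn] with y hy
    have := hp.abs_le ⟨y, hy⟩
    rwa [← extendZero_coe p.1.1 ⟨y, hy⟩] at this
  have hc := hp.apply_center j
  rw [← extendZero_coe p.1.1] at hc
  rcases Real.sign_apply_eq_of_ne_zero _ (hp.ne_zero j) with h | h
  · refine IsLocalMin.fderiv_eq_zero ?_
    filter_upwards [hle] with y hy
    rw [hc, h]
    linarith [(_root_.abs_le.1 hy).1]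
  · refine IsLocalMax.fderiv_eq_zero ?_
    filter_upwards [hle] with y hy
    rw [hc, h]
    linarith [(_root_.abs_le.1 hy).2]

theorem exists_expansion (hp : IsSparsePair α l x p) (j : Fin N) {η : ℝ} (hη : 0 < η) :
    ∃ ρ > 0, ∀ y : Ω, dist (y : E) (x j) < ρ →
      |p.1.1 y - p.1.1 (x j) - hessian p (x j) (y - x j) (y - x j) / 2|
        ≤ η * ‖(y - x j : E)‖ ^ 2 := by
  obtain ⟨ρ, hρ, h⟩ := exists_quadratic_expansion (P := extendZero p.1.1) (x := (x j : E)) (by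
      filter_upwards [isOpen_interior.mem_nhds (hp.mem_interior j)] with y hy
      exact (C1.hasGradientAt p (x := ⟨y, interior_subset hy⟩) hy).differentiableAt)
    (hp.differentiableAt j) (hp.fderiv_center j) hη
  refine ⟨ρ, hρ, fun y hy => ?_⟩
  have := h (y - x j) (by rwa [← dist_eq_norm])
  rwa [add_sub_cancel, extendZero_coe, extendZero_coe] at this

/-- Quadratic growth of `α - σ_j p` near `x_j`, with a constant `β < 1` in front of the Hessian. -/
theorem exists_growth (hp : IsSparsePair α l x p) {β : ℝ} (hβ : β < 1) :
    ∃ ρ > 0, Separated x ρ ∧ ∀ j, ∀ y : Ω, dist (y : E) (x j) ≤ ρ →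
      0 ≤ Real.sign (l j) * p.1.1 y ∧
      β * (-Real.sign (l j) * hessian p (x j) (y - x j) (y - x j)) / 2
        ≤ α - Real.sign (l j) * p.1.1 y := by
  obtain ⟨θ, hθ, hcurv⟩ := hp.curvature
  obtain ⟨ρ₀, hρ₀, hsep⟩ := exists_separated hp.injective
  have hloc : ∀ j, ∃ ρ > 0, ∀ y : Ω, dist (y : E) (x j) ≤ ρ →
      0 ≤ Real.sign (l j) * p.1.1 y ∧
      β * (-Real.sign (l j) * hessian p (x j) (y - x j) (y - x j)) / 2
        ≤ α - Real.sign (l j) * p.1.1 y := by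
    intro j
    -- The Taylor error `(1 - β) θ ‖z‖² / 2` is absorbed by the share `1 - β` of the form `-σ_j
    -- ∇²p(x_j)(z,z) / 2`, because that form is at least `θ‖z‖²`.
    have hη : 0 < (1 - β) * θ / 2 := by
      have : 0 < 1 - β := by linarith
      positivity
    obtain ⟨ρ₁, hρ₁, h₁⟩ := hp.exists_expansion j hη
    have hcont : Continuous fun y : Ω => Real.sign (l j) * p.1.1 y :=
      continuous_const.mul p.1.1.continuous
    have hpos : ∀ᶠ y in 𝓝 (x j), 0 < Real.sign (l j) * p.1.1 y :=
      hcont.continuousAt.eventually (lt_mem_nhds (by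
        exact hp.pos.trans_eq (hp.sign_mul_apply_center j).symm))
    obtain ⟨ρ₂, hρ₂, h₂⟩ := Metric.eventually_nhds_iff.1 hpos
    refine ⟨min ρ₁ ρ₂ / 2, by positivity, fun y hy => ?_⟩
    have hm : 0 < min ρ₁ ρ₂ := lt_min hρ₁ hρ₂
    have hy1 : dist (y : E) (x j) < ρ₁ := by linarith [min_le_left ρ₁ ρ₂]
    have hy2 : dist (y : E) (x j) < ρ₂ := by linarith [min_le_right ρ₁ ρ₂]
    refine ⟨(h₂ hy2).le, ?_⟩
    have h3 := (hp.abs_sign_mul j _).trans_le (h₁ y hy1)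
    have h4 := (_root_.abs_le.1 h3).2
    have h5 := hp.sign_mul_apply_center j
    have h6 := hcurv j (y - x j)
    have h7 : 0 < 1 - β := by linarith
    nlinarith
  obtain ⟨ρ, hρ, h⟩ := exists_pos_le_of_finite hloc
    (fun j ρ ρ' hρ h y hy => h y (hy.trans hρ))
  exact ⟨min ρ ρ₀, lt_min hρ hρ₀, hsep.mono (min_le_right _ _),
    fun j y hy => h j y (hy.trans (min_le_left _ _))⟩

theorem exists_quadratic_growth (hp : IsSparsePair α l x p) :
    ∃ κ > 0, ∃ ρ > 0, Separated x ρ ∧ ∀ j, ∀ y : Ω, dist (y : E) (x j) ≤ ρ →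
      0 ≤ Real.sign (l j) * p.1.1 y ∧
      κ * ‖(y - x j : E)‖ ^ 2 ≤ α - Real.sign (l j) * p.1.1 y := by
  obtain ⟨θ, hθ, hcurv⟩ := hp.curvature
  obtain ⟨ρ, hρ, hsep, h⟩ := hp.exists_growth (β := 1 / 2) (by norm_num)
  refine ⟨θ / 4, by positivity, ρ, hρ, hsep, fun j y hy => ⟨(h j y hy).1, ?_⟩⟩
  have := (h j y hy).2
  have := hcurv j (y - x j)
  linarith

/-- If `ε` bounds the duality gap `α ‖w‖ - ⟨p, w⟩` and `|p + g| ≤ α + δ`, then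
`⟨g, w⟩ ≤ ε + δ ‖w‖`. -/
theorem apply_le_of_gap (hp : IsSparsePair α l x p) {w : RadonMeasure Ω} {ε δ : ℝ}
    (hw : α * ‖w‖ - w p.1.1 ≤ ε) (hδ : 0 ≤ δ) {g : C(Ω, ℝ)}
    (hg : ∀ y, |p.1.1 y + g y| ≤ α + δ) : w g ≤ ε + δ * ‖w‖ := by
  have h1 : ‖p.1.1 + g‖ ≤ α + δ :=
    (ContinuousMap.norm_le _ (by linarith [hp.pos])).2 fun y => hg y
  have h2 := (le_abs_self _).trans (w.le_of_opNorm_le_of_le le_rfl h1)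
  rw [map_add] at h2
  nlinarith

end IsSparsePair

end SparsePair

/-! ### From bounded difference quotients to duality gaps; the lower bound -/

section LowerBound

variable {d : ℕ} {Ω : Compacts (EuclideanSpace ℝ (Fin d))} {N : ℕ}

local notation "E" => EuclideanSpace ℝ (Fin d)

theorem liftedNorm_le {α : ℝ} (w : RadonMeasure Ω) :
    liftedNorm α (embed w) ≤ ((α * ‖w‖ : ℝ) : EReal) :=
  iInf₂_le (f := fun (v : RadonMeasure Ω) (_ : embed v = embed w) => ((α * ‖v‖ : ℝ) : EReal)) w rfl

theorem exists_embed_of_liftedNorm_lt {α : ℝ} {h : NormedDual (C1 Ω)} {a : EReal}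
    (ha : liftedNorm α h < a) : ∃ w : RadonMeasure Ω, embed w = h ∧ ((α * ‖w‖ : ℝ) : EReal) < a := by
  unfold liftedNorm at ha
  simp only [iInf_lt_iff] at ha
  obtain ⟨w, hw, h⟩ := ha
  exact ⟨w, hw, h⟩

namespace IsSparsePair

variable {α : ℝ} {l : Fin N → ℝ} {x : Fin N → Ω} {p : C1 Ω}

theorem apply_le_mul_norm (hp : IsSparsePair α l x p) (w : RadonMeasure Ω) :
    w p.1.1 ≤ α * ‖w‖ := by
  have h1 : ‖p.1.1‖ ≤ α := (ContinuousMap.norm_le _ hp.pos.le).2 hp.abs_le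
  have := (le_abs_self _).trans (w.le_of_opNorm_le_of_le le_rfl h1)
  linarith

/-- Uniqueness of the representing measure is not needed: any `w` inducing the same functional on
`C1 Ω` has the same pairing with `p`, and this pairing bounds `α‖w‖` from below. -/
theorem liftedNorm_embed_sparse (hp : IsSparsePair α l x p) :
    liftedNorm α (embed (sparse l x)) = ((sparse l x p.1.1 : ℝ) : EReal) := by
  refine le_antisymm ((liftedNorm_le _).trans_eq (by rw [hp.norm_sparse])) ?_
  refine le_iInf₂ fun w hw => ?_
  have h1 : w p.1.1 = sparse l x p.1.1 := by
    rw [← embed_apply, hw, embed_apply]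
  rw [← h1]
  exact EReal.coe_le_coe_iff.2 (hp.apply_le_mul_norm w)

/-- A real bound forces a representing measure `w` to exist. As `t ⟨p, h⟩ = ⟨p, w⟩ - ⟨p, u⟩` and `G`
equals `⟨p, u⟩` at the base point, the numerator of the quotient becomes the gap of `w`. -/
theorem exists_of_secondQuotient_lt (hp : IsSparsePair α l x p) {t M : ℝ} (ht : 0 < t)
    {h : NormedDual (C1 Ω)}
    (hM : secondQuotient (liftedNorm α) (embed (sparse l x)) p t h < (M : EReal)) :
    ∃ w : RadonMeasure Ω, embed w = embed (sparse l x) + t • h ∧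
      α * ‖w‖ - w p.1.1 ≤ M * (t ^ 2 / 2) := by
  unfold secondQuotient at hM
  rw [hp.liftedNorm_embed_sparse] at hM
  have ht2 : 0 < t ^ 2 / 2 := by positivity
  rw [EReal.div_lt_iff (EReal.coe_pos.2 ht2) (EReal.coe_ne_top _), ← EReal.coe_mul,
    EReal.sub_lt_iff (Or.inl (EReal.coe_ne_bot _)) (Or.inl (EReal.coe_ne_top _)),
    ← EReal.coe_add,
    EReal.sub_lt_iff (Or.inl (EReal.coe_ne_bot _)) (Or.inl (EReal.coe_ne_top _)),
    ← EReal.coe_add] at hM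
  obtain ⟨w, hw, hlt⟩ := exists_embed_of_liftedNorm_lt hM
  refine ⟨w, hw, ?_⟩
  have h1 : w p.1.1 = sparse l x p.1.1 + t * h p := by
    rw [← embed_apply, hw]
    simp
  have h2 := EReal.coe_lt_coe_iff.1 hlt
  linarith

theorem secondQuotient_le (hp : IsSparsePair α l x p) {t : ℝ} (ht : 0 < t)
    {h : NormedDual (C1 Ω)} {w : RadonMeasure Ω} (hw : embed w = embed (sparse l x) + t • h) :
    secondQuotient (liftedNorm α) (embed (sparse l x)) p t h
      ≤ (((α * ‖w‖ - w p.1.1) / (t ^ 2 / 2) : ℝ) : EReal) := by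
  unfold secondQuotient
  have ht2 : 0 < t ^ 2 / 2 := by positivity
  have h1 : w p.1.1 = sparse l x p.1.1 + t * h p := by
    rw [← embed_apply, hw]
    simp
  rw [hp.liftedNorm_embed_sparse, EReal.coe_div _ (t ^ 2 / 2), ← hw]
  refine EReal.div_le_div_right_of_nonneg (EReal.coe_nonneg.2 ht2.le) ?_
  have h2 : ((α * ‖w‖ - w p.1.1 : ℝ) : EReal)
      = ((α * ‖w‖ : ℝ) : EReal) - ((sparse l x p.1.1 : ℝ) : EReal) - ((t * h p : ℝ) : EReal) := by
    rw [← EReal.coe_sub, ← EReal.coe_sub, h1]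
    congr 1
    ring
  rw [h2]
  exact EReal.sub_le_sub (EReal.sub_le_sub (liftedNorm_le w) le_rfl) le_rfl

end IsSparsePair

/-- Measures `w k` whose difference quotients `(w k - u) / t k` converge weakly* to `h` in
`C¹(Ω)*`, and whose duality gap is of order `(t k)²`. -/
structure IsBoundedQuotientSeq (α : ℝ) (l : Fin N → ℝ) (x : Fin N → Ω) (p : C1 Ω) (M : ℝ)
    (t : ℕ → ℝ) (w : ℕ → RadonMeasure Ω) (h : NormedDual (C1 Ω)) : Prop where
  pos (k : ℕ) : 0 < t k
  tendsto_zero : Tendsto t atTop (𝓝 0)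
  gap (k : ℕ) : α * ‖w k‖ - w k p.1.1 ≤ M * (t k ^ 2 / 2)
  tendsto (f : C1 Ω) : Tendsto (fun k => (w k f.1.1 - sparse l x f.1.1) / t k) atTop (𝓝 (h f))

theorem IsSparsePair.exists_isBoundedQuotientSeq {α : ℝ} {l : Fin N → ℝ} {x : Fin N → Ω}
    {p : C1 Ω} (hp : IsSparsePair α l x p) {t : ℕ → ℝ} (ht : ∀ k, 0 < t k)
    (ht0 : Tendsto t atTop (𝓝 0)) {hs : ℕ → NormedDual (C1 Ω)} {h : NormedDual (C1 Ω)}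
    (hh : WeakStarTendsto hs h) {M : ℝ}
    (hM : liminf (fun k => secondQuotient (liftedNorm α) (embed (sparse l x)) p (t k) (hs k)) atTop
      < (M : EReal)) :
    ∃ (t' : ℕ → ℝ) (w : ℕ → RadonMeasure Ω), IsBoundedQuotientSeq α l x p M t' w h := by
  obtain ⟨φ, hφ, hlt⟩ := extraction_of_frequently_atTop (frequently_lt_of_liminf_lt (h := hM))
  choose w hw hgap using fun k => hp.exists_of_secondQuotient_lt (ht (φ k)) (hlt k)
  refine ⟨t ∘ φ, w, fun k => ht _, ht0.comp hφ.tendsto_atTop, hgap, fun f => ?_⟩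
  refine ((weakStarTendsto_iff.1 hh f).comp hφ.tendsto_atTop).congr fun k => ?_
  have h1 : w k f.1.1 = sparse l x f.1.1 + t (φ k) * hs (φ k) f := by
    rw [← embed_apply, hw]
    simp
  rw [h1]
  have := (ht (φ k)).ne'
  simp only [Function.comp_apply]
  field_simp
  ring

namespace IsBoundedQuotientSeq

variable {α : ℝ} {l : Fin N → ℝ} {x : Fin N → Ω} {p : C1 Ω} {M : ℝ} {t : ℕ → ℝ}
  {w : ℕ → RadonMeasure Ω} {h : NormedDual (C1 Ω)}

theorem tendsto_apply (hw : IsBoundedQuotientSeq α l x p M t w h) (f : C1 Ω) :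
    Tendsto (fun k => w k f.1.1) atTop (𝓝 (sparse l x f.1.1)) := by
  have := ((hw.tendsto_zero.mul (hw.tendsto f)).const_add (sparse l x f.1.1))
  rw [zero_mul, add_zero] at this
  refine this.congr fun k => ?_
  have := (hw.pos k).ne'
  field_simp
  ring

/-- The gap bounds `α‖w k‖` by `⟨p, w k⟩` plus a null sequence, and `⟨p, w k⟩` converges. -/
theorem exists_norm_le (hw : IsBoundedQuotientSeq α l x p M t w h) (hα : 0 < α) :
    ∃ B, ∀ k, ‖w k‖ ≤ B := by
  have h1 : Tendsto (fun k => (w k p.1.1 + M * (t k ^ 2 / 2)) / α) atTop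
      (𝓝 ((sparse l x p.1.1 + M * (0 ^ 2 / 2)) / α)) :=
    ((hw.tendsto_apply p).add (((hw.tendsto_zero.pow 2).div_const 2).const_mul M)).div_const α
  obtain ⟨B, hB⟩ := h1.bddAbove_range
  refine ⟨B, fun k => ?_⟩
  refine le_trans ?_ (hB ⟨k, rfl⟩)
  have := hw.gap k
  rw [le_div_iff₀ hα]
  linarith

theorem tendsto_of_sparse_eq_zero (hw : IsBoundedQuotientSeq α l x p M t w h) {f : C1 Ω}
    (hf : sparse l x f.1.1 = 0) : Tendsto (fun k => w k f.1.1 / t k) atTop (𝓝 (h f)) :=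
  (hw.tendsto f).congr fun k => by rw [hf, sub_zero]

end IsBoundedQuotientSeq

theorem exists_inner_eq (b : E →L[ℝ] ℝ) : ∃ v : E, ∀ z, inner ℝ v z = b z :=
  ⟨(InnerProductSpace.toDual ℝ E).symm b, fun z => by simp⟩

/-- A measure on the contact set does not charge the ball around `x j` on which `α - σ_j p` grows
quadratically. -/
theorem IsSparsePair.integral_bump_mul_eq_zero {α : ℝ} {l : Fin N → ℝ} {x : Fin N → Ω} {p : C1 Ω}
    (hp : IsSparsePair α l x p) {ρ : ℝ} {hρ : 0 < ρ} {j : Fin N}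
    (hpos : ∀ y : Ω, dist (y : E) (x j) ≤ ρ → 0 ≤ Real.sign (l j) * p.1.1 y)
    (hlt : ∀ y : Ω, dist (y : E) (x j) ≤ ρ → y ≠ x j → Real.sign (l j) * p.1.1 y < α)
    {τ : ℝ} (hτ : |τ| = 1) {μ : Measure Ω} (hμ : μ (contactSet p x (τ * α))ᶜ = 0) (f : C1 Ω) :
    ∫ y, (C1.mul (C1.bump (x j : E) ρ hρ) f).1.1 y ∂μ = 0 := by
  refine integral_eq_zero_of_ae ?_
  filter_upwards [compl_mem_ae_iff.2 hμ] with y hy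
  rw [compl_compl] at hy
  obtain ⟨hy1, hy2⟩ := hy
  simp only [Set.mem_ofPred_eq] at hy1
  by_contra hne
  have hb : (C1.bump (x j : E) ρ hρ : C1 Ω).1.1 y ≠ 0 := fun h0 => hne (by simp [h0])
  have hd := (C1.dist_lt_of_bump_ne_zero hb).le
  have h1 := hpos y hd
  have h2 := hlt y hd (fun h => hy2 ⟨j, h.symm⟩)
  have h3 : |Real.sign (l j) * p.1.1 y| = α := by
    rw [hp.abs_sign_mul, hy1, abs_mul, hτ, one_mul, abs_of_pos hp.pos]
  rw [abs_of_nonneg h1] at h3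
  linarith

theorem sparse_bump {l : Fin N → ℝ} {x : Fin N → Ω} {ρ : ℝ} {hρ : 0 < ρ} (hsep : Separated x ρ)
    (j : Fin N) : sparse l x (C1.bump (x j : E) ρ hρ : C1 Ω).1.1 = l j := by
  simp [sparse_apply, hsep.bump_apply_center]

theorem sparse_bump_mul {l : Fin N → ℝ} {x : Fin N → Ω} {ρ : ℝ} {hρ : 0 < ρ}
    (hsep : Separated x ρ) (j : Fin N) {f : C1 Ω} (hf : f.1.1 (x j) = 0) :
    sparse l x (C1.mul (C1.bump (x j : E) ρ hρ) f).1.1 = 0 := by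
  rw [sparse_apply]
  refine Finset.sum_eq_zero fun i _ => ?_
  rw [C1.mul_fst, hsep.bump_apply_center]
  split_ifs with hij
  · subst hij
    simp [hf]
  · simp

theorem apply_sum_smul_sub (w : RadonMeasure Ω) (a r : Fin N → ℝ) (s : ℝ) (f g : Fin N → C1 Ω) :
    w (∑ j, a j • (s • f j - r j • g j)).1.1
      = ∑ j, a j * (s * w (f j).1.1 - r j * w (g j).1.1) := by
  rw [← embed_apply, map_sum]
  refine Finset.sum_congr rfl fun j _ => ?_
  rw [embed_apply]
  change w (a j • (s • (f j).1.1 - r j • (g j).1.1)) = _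
  simp

/-- Admissibility of cut-off test functions. At most one cutoff is active at `y`. After
multiplication by `σ_j`, the upper bound is the growth hypothesis on `m j`, and the lower bound
holds because `σ_j p ≥ 0` near `x_j` while `|m j| ≤ α`. -/
theorem IsSparsePair.abs_add_sum_bump_le {α : ℝ} {l : Fin N → ℝ} {x : Fin N → Ω} {p : C1 Ω}
    (hp : IsSparsePair α l x p) {ρ : ℝ} (hρ : 0 < ρ) (hsep : Separated x ρ) {y : Ω}
    {m : Fin N → ℝ} (hm : ∀ j, |m j| ≤ α)
    (hpos : ∀ j, dist (y : E) (x j) ≤ ρ → 0 ≤ Real.sign (l j) * p.1.1 y)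
    (hle : ∀ j, dist (y : E) (x j) ≤ ρ → m j ≤ α - Real.sign (l j) * p.1.1 y) :
    |p.1.1 y + ∑ j, (C1.bump (x j : E) ρ hρ : C1 Ω).1.1 y * (Real.sign (l j) * m j)| ≤ α := by
  rcases hsep.sum_bump_cases hρ y with h | ⟨j, hj, h⟩
  · rw [h, add_zero]
    exact hp.abs_le y
  · rw [h]
    have hχ0 : 0 ≤ (C1.bump (x j : E) ρ hρ : C1 Ω).1.1 y := C1.bump_nonneg _ _ _ _
    have hχ1 : (C1.bump (x j : E) ρ hρ : C1 Ω).1.1 y ≤ 1 := C1.bump_le_one _ _ _ _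
    generalize (C1.bump (x j : E) ρ hρ : C1 Ω).1.1 y = χ at hχ0 hχ1
    have hp0 := hpos j hj.le
    have hm2 := hle j hj.le
    have h6 : Real.sign (l j) * p.1.1 y ≤ α :=
      (le_abs_self _).trans ((hp.abs_sign_mul j _).trans_le (hp.abs_le y))
    rw [← hp.abs_sign_mul j]
    have h7 : Real.sign (l j) * (p.1.1 y + χ * (Real.sign (l j) * m j))
        = Real.sign (l j) * p.1.1 y + χ * m j := by
      have := sign_mul_sign (hp.ne_zero j)
      linear_combination χ * m j * this
    rw [h7]
    have h8 := _root_.abs_le.1 (hm j)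
    have h9 := hp.pos
    exact _root_.abs_le.2 ⟨by nlinarith, by nlinarith⟩

/-- Near `x_j` the test function is `σ_j` times the tangent of `z ↦ β A_j(z,z)/2` at `z = t D_j`,
that is `t⟨v_j, z⟩ - t² e_j`. It lies below `α - σ_j p`, and its two terms become comparable after
division by `t²`: the affine part sees `h`, the constant part sees the masses `l_j`. -/
theorem IsBoundedQuotientSeq.mul_le_of_direction {α : ℝ} {l : Fin N → ℝ} {x : Fin N → Ω}
    {p : C1 Ω} (hp : IsSparsePair α l x p) {M : ℝ} {t : ℕ → ℝ} {w : ℕ → RadonMeasure Ω}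
    {c : Fin N → ℝ} {V : Fin N → E} {μ ν : Measure Ω} [IsFiniteMeasure μ] [IsFiniteMeasure ν]
    (hμ : μ (contactSet p x α)ᶜ = 0) (hν : ν (contactSet p x (-α))ᶜ = 0)
    (hw : IsBoundedQuotientSeq α l x p M t w (direction x c V μ ν)) {β : ℝ} (hβ0 : 0 < β)
    (hβ1 : β < 1) : β * (-∑ j, 1 / l j * hessian p (x j) (V j) (V j)) ≤ M := by
  obtain ⟨ρ, hρ, hsep, hgr⟩ := hp.exists_growth hβ1
  obtain ⟨θ, hθ, hcurv⟩ := hp.curvature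
  obtain ⟨A, hA⟩ : ∃ A : Fin N → E →L[ℝ] E →L[ℝ] ℝ, ∀ j z z',
      A j z z' = -Real.sign (l j) * hessian p (x j) z z' :=
    ⟨fun j => (-Real.sign (l j)) • hessian p (x j), fun j z z' => by simp⟩
  have hAnn : ∀ j z, θ * ‖z‖ ^ 2 ≤ A j z z := fun j z => by rw [hA]; exact hcurv j z
  have hgrow : ∀ j, ∀ y : Ω, dist (y : E) (x j) ≤ ρ →
      β * A j (y - x j) (y - x j) / 2 ≤ α - Real.sign (l j) * p.1.1 y := fun j y hy => by
    rw [hA]; exact (hgr j y hy).2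
  have hlt : ∀ j, ∀ y : Ω, dist (y : E) (x j) ≤ ρ → y ≠ x j →
      Real.sign (l j) * p.1.1 y < α := fun j y hy hne => by
    have h1 := hgrow j y hy
    have h2 := hAnn j (y - x j)
    have h3 : 0 < ‖(y - x j : E)‖ := norm_pos_iff.2 (sub_ne_zero.2 fun h => hne (Subtype.ext h))
    have h4 : 0 < β * (θ * ‖(y - x j : E)‖ ^ 2) := by positivity
    nlinarith
  obtain ⟨D, hD⟩ : ∃ D : Fin N → E, ∀ j, D j = (1 / l j) • V j := ⟨_, fun _ => rfl⟩
  -- The gradient of `z ↦ β A_j(z,z)/2` at `D j`, written with both orders of arguments so that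
  -- symmetry of the Hessian plays no role.
  choose v hv using fun j => exists_inner_eq ((β / 2) • ((A j).flip (D j) + A j (D j)))
  set e : Fin N → ℝ := fun j => β / 2 * A j (D j) (D j) with he
  set g : Fin N → C1 Ω := fun j => C1.mul (C1.bump (x j : E) ρ hρ) (C1.affine (x j) (v j)) with hg
  set F : ℝ → C1 Ω := fun s => ∑ j, Real.sign (l j) •
    (s • g j - (s ^ 2 * e j) • C1.bump (x j : E) ρ hρ) with hF
  have hsmall : ∀ᶠ k in atTop, ∀ j,
      t k * ‖(C1.affine (x j : E) (v j) : C1 Ω)‖ + t k ^ 2 * |e j| ≤ α := by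
    refine eventually_all.2 fun j => ?_
    have h1 : Tendsto (fun k => t k * ‖(C1.affine (x j : E) (v j) : C1 Ω)‖ + t k ^ 2 * |e j|) atTop
        (𝓝 (0 * ‖(C1.affine (x j : E) (v j) : C1 Ω)‖ + 0 ^ 2 * |e j|)) :=
      (hw.tendsto_zero.mul_const _).add ((hw.tendsto_zero.pow 2).mul_const _)
    refine (h1.eventually_lt_const (u := α) ?_).mono fun k hk => le_of_lt hk
    rw [zero_mul, zero_pow two_ne_zero, zero_mul, add_zero]
    exact hp.pos
  have hbound : ∀ᶠ k in atTop,
      ∑ j, Real.sign (l j) * (w k (g j).1.1 / t k - e j * w k (C1.bump (x j : E) ρ hρ : C1 Ω).1.1)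
        ≤ M / 2 := by
    filter_upwards [hsmall] with k hk
    have htk := hw.pos k
    have h1 : w k (F (t k)).1.1 ≤ M * (t k ^ 2 / 2) + 0 * ‖w k‖ := by
      refine hp.apply_le_of_gap (hw.gap k) le_rfl fun y => ?_
      have hFy : (F (t k)).1.1 y = ∑ j, (C1.bump (x j : E) ρ hρ : C1 Ω).1.1 y *
          (Real.sign (l j) * (t k * inner ℝ (v j) (y - x j : E) - t k ^ 2 * e j)) := by
        refine (apply_sum_smul_sub (dirac y) _ _ _ _ _).trans ?_
        refine Finset.sum_congr rfl fun j _ => ?_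
        simp only [hg, dirac_apply, C1.mul_fst, C1.affine_fst]
        ring
      rw [hFy, add_zero]
      refine hp.abs_add_sum_bump_le hρ hsep (fun j => ?_) (fun j hj => (hgr j y hj).1)
        (fun j hj => ?_)
      · refine le_trans ?_ (hk j)
        have h3 : |inner ℝ (v j) (y - x j : E)| ≤ ‖(C1.affine (x j : E) (v j) : C1 Ω)‖ :=
          abs_apply_le_norm (C1.affine (x j : E) (v j) : C1 Ω) y
        refine (abs_sub _ _).trans ?_
        rw [abs_mul, abs_mul, abs_of_pos htk, abs_of_pos (pow_pos htk 2)]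
        gcongr
      · refine le_trans ?_ (hgrow j y hj)
        -- The tangent lies below the quadratic because the difference is `β/2` times `A_j`
        -- evaluated at `z - t D_j`.
        have h4 := hAnn j ((y - x j : E) - t k • D j)
        have h5 : 0 ≤ A j ((y - x j : E) - t k • D j) ((y - x j : E) - t k • D j) :=
          le_trans (by positivity) h4
        rw [hv]
        simp only [he, map_sub, map_smul, sub_apply, smul_apply, add_apply,
          ContinuousLinearMap.flip_apply, smul_eq_mul] at h5 ⊢
        nlinarith
    have h2 : w k (F (t k)).1.1 = t k ^ 2 * ∑ j, Real.sign (l j) *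
        (w k (g j).1.1 / t k - e j * w k (C1.bump (x j : E) ρ hρ : C1 Ω).1.1) := by
      refine (apply_sum_smul_sub (w k) _ _ _ _ _).trans ?_
      rw [Finset.mul_sum]
      refine Finset.sum_congr rfl fun j _ => ?_
      field_simp
    rw [h2, zero_mul, add_zero] at h1
    have h3 : 0 < t k ^ 2 := by positivity
    refine le_of_mul_le_mul_left ?_ h3
    linarith
  have hlim : Tendsto (fun k => ∑ j, Real.sign (l j) *
      (w k (g j).1.1 / t k - e j * w k (C1.bump (x j : E) ρ hρ : C1 Ω).1.1)) atTop
      (𝓝 (∑ j, Real.sign (l j) * (direction x c V μ ν (g j) - e j * l j))) := by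
    refine tendsto_finsetSum _ fun j _ => Tendsto.const_mul _ (Tendsto.sub ?_ ?_)
    · exact hw.tendsto_of_sparse_eq_zero (sparse_bump_mul hsep j (by simp))
    · have := hw.tendsto_apply (C1.bump (x j : E) ρ hρ)
      rw [sparse_bump hsep] at this
      exact this.const_mul _
  have hle := le_of_tendsto hlim hbound
  -- Only the `V j` term survives: `g j` vanishes at every `x i`, its gradient there is `v j` for `i
  -- = j` and zero otherwise, and strict growth keeps the contact sets out of its support.
  have hdir : ∀ j, direction x c V μ ν (g j) = inner ℝ (v j) (V j) := fun j => by
    rw [direction_apply, hp.integral_bump_mul_eq_zero (fun y hy => (hgr j y hy).1) (hlt j)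
        (τ := 1) (by simp) (by simpa using hμ),
      hp.integral_bump_mul_eq_zero (fun y hy => (hgr j y hy).1) (hlt j)
        (τ := -1) (by simp) (by simpa using hν), add_zero, sub_zero,
      Finset.sum_eq_single j]
    · simp only [hg, C1.mul_fst, C1.mul_snd, hsep.bump_apply_center, hsep.bump_snd_center]
      simp [real_inner_comm]
    · intro i _ hij
      simp only [hg, C1.mul_fst, C1.mul_snd, hsep.bump_apply_center, hsep.bump_snd_center]
      simp [Ne.symm hij]
    · simp
  have hsum : ∑ j, Real.sign (l j) * (direction x c V μ ν (g j) - e j * l j)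
      = β * (-∑ j, 1 / l j * hessian p (x j) (V j) (V j)) / 2 := by
    rw [← Finset.sum_neg_distrib, Finset.mul_sum, Finset.sum_div]
    refine Finset.sum_congr rfl fun j _ => ?_
    rw [hdir, hv]
    have h1 := sign_mul_sign (hp.ne_zero j)
    have h2 := hp.ne_zero j
    simp only [he, hD, map_smul, smul_apply, add_apply, ContinuousLinearMap.flip_apply,
      smul_eq_mul, hA]
    field_simp
    linear_combination (-hessian p (x j) (V j) (V j)) * h1
  rw [hsum] at hle
  linarith

theorem IsBoundedQuotientSeq.le_of_direction {α : ℝ} {l : Fin N → ℝ} {x : Fin N → Ω}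
    {p : C1 Ω} (hp : IsSparsePair α l x p) {M : ℝ} {t : ℕ → ℝ} {w : ℕ → RadonMeasure Ω}
    {c : Fin N → ℝ} {V : Fin N → E} {μ ν : Measure Ω} [IsFiniteMeasure μ] [IsFiniteMeasure ν]
    (hμ : μ (contactSet p x α)ᶜ = 0) (hν : ν (contactSet p x (-α))ᶜ = 0)
    (hw : IsBoundedQuotientSeq α l x p M t w (direction x c V μ ν)) :
    -∑ j, 1 / l j * hessian p (x j) (V j) (V j) ≤ M := by
  set K := -∑ j, 1 / l j * hessian p (x j) (V j) (V j)
  have h1 : Tendsto (fun β : ℝ => β * K) (𝓝[<] 1) (𝓝 (1 * K)) :=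
    ((continuous_id.mul continuous_const).tendsto 1).mono_left nhdsWithin_le_nhds
  rw [one_mul] at h1
  refine le_of_tendsto h1 ?_
  filter_upwards [Ioo_mem_nhdsLT (zero_lt_one' ℝ)] with β hβ
  exact hw.mul_le_of_direction hp hμ hν hβ.1 hβ.2

end LowerBound

/-! ### Limit directions near the points `x j` -/

section Representation

variable {d : ℕ} {Ω : Compacts (EuclideanSpace ℝ (Fin d))} {N : ℕ}

local notation "E" => EuclideanSpace ℝ (Fin d)

/-- The cone of pairs in `C(Ω) × C(Ω; ℝᵈ)` with nonnegative first component. -/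
def nonnegFstCone (Ω : Compacts (EuclideanSpace ℝ (Fin d))) :
    PointedCone ℝ (C(Ω, ℝ) × C(Ω, E)) where
  carrier := {f | ∀ y, 0 ≤ f.1 y}
  add_mem' hf hg y := add_nonneg (hf y) (hg y)
  zero_mem' _ := le_rfl
  smul_mem' c _ hf y := mul_nonneg c.2 (hf y)

open scoped CompactlySupported in
/-- A positive linear functional on `C¹(Ω)` is given by a finite measure. -/
theorem exists_measure_of_nonneg (P : C1 Ω →ₗ[ℝ] ℝ)
    (hP : ∀ f : C1 Ω, (∀ y, 0 ≤ f.1.1 y) → 0 ≤ P f) :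
    ∃ μ : Measure Ω, IsFiniteMeasure μ ∧ ∀ f : C1 Ω, P f = ∫ y, f.1.1 y ∂μ := by
  obtain ⟨g, hg, hg0⟩ := riesz_extension (nonnegFstCone Ω) ⟨C1 Ω, P⟩ (fun f hf => hP f hf)
    -- Constants dominate every pair modulo the cone, as the extension theorem requires.
    fun f => ⟨‖f.1‖ • C1.one, fun y => by
      have h1 := (abs_le.1 (f.1.norm_coe_le_norm y)).1
      change 0 ≤ ‖f.1‖ * 1 + f.1 y
      linarith⟩
  -- Both `(0, v)` and `(0, -v)` lie in the cone, so the positive extension ignores the gradient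
  -- component and descends to `C(Ω)`.
  have hsnd : ∀ v : C(Ω, E), g (0, v) = 0 := fun v => by
    have h1 := hg0 (0, v) fun y => le_rfl
    have h2 := hg0 (-(0, v)) fun y => by simp
    rw [map_neg] at h2
    linarith
  let Λ : C_c(Ω, ℝ) →ₚ[ℝ] ℝ := PositiveLinearMap.mk₀
    { toFun := fun φ => g (φ.toContinuousMap, 0)
      map_add' := fun φ ψ => by
        rw [← map_add]
        congr 1
        exact Prod.ext rfl (add_zero _).symm
      map_smul' := fun c φ => by
        rw [← map_smul]
        congr 1
        exact Prod.ext rfl (smul_zero (A := C(Ω, E)) c).symm }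
    fun φ hφ => hg0 _ hφ
  refine ⟨RealRMK.rieszMeasure Λ, inferInstance, fun f => ?_⟩
  have h1 := RealRMK.integral_rieszMeasure Λ
    (CompactlySupportedContinuousMap.continuousMapEquiv f.1.1)
  have h2 : Λ (CompactlySupportedContinuousMap.continuousMapEquiv f.1.1) = g (f.1.1, 0) := rfl
  rw [h2] at h1
  have h3 : P f = g f.1 := (hg f).symm
  have h4 : f.1 = (f.1.1, 0) + (0, f.1.2) := by simp
  rw [h3, h4, map_add, hsnd, add_zero, ← h1]
  simp

/-- Close to `x_j` this is differentiability with zero value and gradient; at distance at least `δ`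
the quadratic term with `C = ‖f‖/δ²` already exceeds `‖f‖`. -/
theorem IsSparsePair.exists_abs_apply_le {α : ℝ} {l : Fin N → ℝ} {x : Fin N → Ω} {p : C1 Ω}
    (hp : IsSparsePair α l x p) {j : Fin N} {f : C1 Ω} (hf : f.1.1 (x j) = 0)
    (hf' : f.1.2 (x j) = 0) {η : ℝ} (hη : 0 < η) :
    ∃ C, 0 ≤ C ∧ ∀ y : Ω,
      |f.1.1 y| ≤ η * ‖(y - x j : E)‖ + C * ‖(y - x j : E)‖ ^ 2 := by
  have h1 := (C1.hasGradientAt f (hp.mem_interior j)).hasFDerivAt.isLittleO.def hη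
  obtain ⟨δ, hδ, hb⟩ := Metric.eventually_nhds_iff.1 h1
  refine ⟨‖f‖ / δ ^ 2, by positivity, fun y => ?_⟩
  rcases lt_or_ge (dist (y : E) (x j)) δ with hy | hy
  · have h2 := hb hy
    rw [hf', map_zero, zero_apply, sub_zero, extendZero_coe, extendZero_coe, hf,
      sub_zero, Real.norm_eq_abs] at h2
    exact h2.trans (le_add_of_nonneg_right (by positivity))
  · rw [dist_eq_norm] at hy
    have h2 : ‖f‖ ≤ ‖f‖ / δ ^ 2 * ‖(y - x j : E)‖ ^ 2 := by
      rw [div_mul_eq_mul_div, le_div_iff₀ (by positivity)]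
      gcongr
    exact (abs_apply_le_norm f y).trans (h2.trans (le_add_of_nonneg_left (by positivity)))

namespace IsBoundedQuotientSeq

variable {α : ℝ} {l : Fin N → ℝ} {x : Fin N → Ω} {p : C1 Ω} {M : ℝ} {t : ℕ → ℝ}
  {w : ℕ → RadonMeasure Ω} {h : NormedDual (C1 Ω)}

/-- Here `|f| ≤ η r + C r²` with `η` arbitrarily small, where `r` is the distance to `x_j`. Testing
with `±(t/η) χ_j f` costs only an excess `δ` of order `t²`, because quadratic growth absorbs the
rest. Dividing by `t²/η` gives `|h(χ_j f)| ≤ η K` with `K` independent of `η`. -/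
theorem apply_bump_mul_eq_zero (hp : IsSparsePair α l x p)
    (hw : IsBoundedQuotientSeq α l x p M t w h) {κ ρ : ℝ} (hκ : 0 < κ) (hρ : 0 < ρ)
    (hsep : Separated x ρ) {j : Fin N}
    (hpos : ∀ y : Ω, dist (y : E) (x j) ≤ ρ → 0 ≤ Real.sign (l j) * p.1.1 y)
    (hgr : ∀ y : Ω, dist (y : E) (x j) ≤ ρ →
      κ * ‖(y - x j : E)‖ ^ 2 ≤ α - Real.sign (l j) * p.1.1 y)
    {f : C1 Ω} (hf : f.1.1 (x j) = 0) (hf' : f.1.2 (x j) = 0) :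
    h (C1.mul (C1.bump (x j : E) ρ hρ) f) = 0 := by
  obtain ⟨B, hB⟩ := hw.exists_norm_le hp.pos
  set g : C1 Ω := C1.mul (C1.bump (x j : E) ρ hρ) f with hg
  have hlim := hw.tendsto_of_sparse_eq_zero (f := g) (sparse_bump_mul hsep j hf)
  set K := M / 2 + B / (2 * κ) with hK
  have key : ∀ η > 0, |h g| ≤ η * K := by
    intro η hη
    obtain ⟨C, hC, hfC⟩ := hp.exists_abs_apply_le hf hf' hη
    have hs0 : Tendsto (fun k => t k / η) atTop (𝓝 0) := by
      simpa using hw.tendsto_zero.div_const η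
    have hs1 : ∀ᶠ k in atTop, t k / η * C < κ / 2 := by
      have := hs0.mul_const C
      rw [zero_mul] at this
      exact this.eventually_lt_const (by positivity)
    have hs2 : ∀ᶠ k in atTop, t k / η * ‖f‖ < α := by
      have := hs0.mul_const ‖f‖
      rw [zero_mul] at this
      exact this.eventually_lt_const hp.pos
    refine le_of_tendsto hlim.abs ?_
    filter_upwards [hs1, hs2] with k hk1 hk2
    have htk := hw.pos k
    have hs : 0 < t k / η := by positivity
    have hst : t k = t k / η * η := by field_simp
    set s := t k / η with hsdef
    have bound : ∀ τ : ℝ, |τ| = 1 → τ * w k g.1.1 ≤ t k * (η * K) := by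
      intro τ hτ
      -- Young's inequality `s η r ≤ s²η²/(2κ) + κr²/2` yields `δ = s²η²/(2κ)`, which is `t²/(2κ)`
      -- as `s η = t`. The other half of `κr²` pays for `s C r²`.
      have h1 : w k ((s * τ) • g.1.1) ≤ M * (t k ^ 2 / 2) + s ^ 2 * η ^ 2 / (2 * κ) * ‖w k‖ := by
        refine hp.apply_le_of_gap (hw.gap k) (by positivity) fun y => ?_
        change |p.1.1 y + s * τ * ((C1.bump (x j : E) ρ hρ : C1 Ω).1.1 y * f.1.1 y)| ≤ _
        have hδ : 0 ≤ s ^ 2 * η ^ 2 / (2 * κ) := by positivity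
        by_cases hy : (C1.bump (x j : E) ρ hρ : C1 Ω).1.1 y = 0
        · rw [hy, zero_mul, mul_zero, add_zero]
          linarith [hp.abs_le y]
        · have hd := (C1.dist_lt_of_bump_ne_zero hy).le
          have hχ0 : 0 ≤ (C1.bump (x j : E) ρ hρ : C1 Ω).1.1 y := C1.bump_nonneg _ _ _ _
          have hχ1 : (C1.bump (x j : E) ρ hρ : C1 Ω).1.1 y ≤ 1 := C1.bump_le_one _ _ _ _
          generalize (C1.bump (x j : E) ρ hρ : C1 Ω).1.1 y = χ at hχ0 hχ1
          have h2 := hpos y hd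
          have h3 := hgr y hd
          have h4 := hfC y
          generalize ‖(y - x j : E)‖ = r at h3 h4
          have h5 : |s * τ * (χ * f.1.1 y)| ≤ s * |f.1.1 y| := by
            rw [abs_mul, abs_mul, abs_mul, hτ, abs_of_pos hs, abs_of_nonneg hχ0, mul_one]
            have := mul_le_of_le_one_left (abs_nonneg (f.1.1 y)) hχ1
            gcongr
          have h6 : s * |f.1.1 y| ≤ α :=
            (mul_le_mul_of_nonneg_left (abs_apply_le_norm f y) hs.le).trans hk2.le
          have h7 : s * |f.1.1 y| ≤ s ^ 2 * η ^ 2 / (2 * κ) + κ * r ^ 2 := by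
            have h8 : s * η * r ≤ s ^ 2 * η ^ 2 / (2 * κ) + κ / 2 * r ^ 2 := by
              have : s ^ 2 * η ^ 2 / (2 * κ) + κ / 2 * r ^ 2 - s * η * r
                  = (s * η - κ * r) ^ 2 / (2 * κ) := by
                field_simp
                ring
              have h9 : 0 ≤ (s * η - κ * r) ^ 2 / (2 * κ) := by positivity
              linarith
            have h10 := mul_le_mul_of_nonneg_left h4 hs.le
            have h11 := mul_le_mul_of_nonneg_right hk1.le (sq_nonneg r)
            nlinarith
          rw [← hp.abs_sign_mul j, mul_add]
          have h8 : |Real.sign (l j) * (s * τ * (χ * f.1.1 y))| ≤ s * |f.1.1 y| := by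
            rwa [hp.abs_sign_mul]
          have h9 := abs_le.1 h8
          exact abs_le.2 ⟨by linarith, by linarith⟩
      rw [map_smul, smul_eq_mul] at h1
      have h2 : s ^ 2 * η ^ 2 / (2 * κ) * ‖w k‖ ≤ s ^ 2 * η ^ 2 / (2 * κ) * B := by
        gcongr
        exact hB k
      have h3 : s * (τ * w k g.1.1) ≤ s * (t k * (η * K)) := by
        have h4 : s * (t k * (η * K)) = M * (t k ^ 2 / 2) + s ^ 2 * η ^ 2 / (2 * κ) * B := by
          rw [hK, hst]
          field_simp
        linarith
      exact le_of_mul_le_mul_left h3 hs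
    have b1 := bound 1 (by simp)
    have b2 := bound (-1) (by simp)
    rw [abs_div, abs_of_pos htk, div_le_iff₀ htk, mul_comm _ (t k)]
    exact abs_le.2 ⟨by linarith, by linarith⟩
  have h0 : Tendsto (fun η : ℝ => η * K) (𝓝[>] 0) (𝓝 (0 * K)) :=
    ((continuous_id.mul continuous_const).tendsto 0).mono_left nhdsWithin_le_nhds
  rw [zero_mul] at h0
  exact abs_nonpos_iff.1 (ge_of_tendsto h0 (eventually_mem_nhdsWithin.mono fun η hη => key η hη))

/-- Subtracting from `f` its first-order Taylor polynomial at `x_j` leaves a function that `h(χ_j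
·)` annihilates. -/
theorem exists_local_form (hp : IsSparsePair α l x p)
    (hw : IsBoundedQuotientSeq α l x p M t w h) {κ ρ : ℝ} (hκ : 0 < κ) (hρ : 0 < ρ)
    (hsep : Separated x ρ) {j : Fin N}
    (hpos : ∀ y : Ω, dist (y : E) (x j) ≤ ρ → 0 ≤ Real.sign (l j) * p.1.1 y)
    (hgr : ∀ y : Ω, dist (y : E) (x j) ≤ ρ →
      κ * ‖(y - x j : E)‖ ^ 2 ≤ α - Real.sign (l j) * p.1.1 y) :
    ∃ (c : ℝ) (V : E), ∀ f : C1 Ω, h (C1.mul (C1.bump (x j : E) ρ hρ) f)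
      = c * f.1.1 (x j) + inner ℝ V (f.1.2 (x j)) := by
  let b : E →ₗ[ℝ] ℝ :=
    { toFun := fun v => h (C1.mul (C1.bump (x j : E) ρ hρ) (C1.affine (x j : E) v))
      map_add' := fun v v' => by
        rw [← map_add, ← map_add]
        congr 2
        refine Subtype.ext (Prod.ext ?_ rfl)
        ext y
        exact inner_add_left v v' (y - x j : E)
      map_smul' := fun a v => by
        rw [RingHom.id_apply, ← map_smul, ← map_smul]
        congr 2
        refine Subtype.ext (Prod.ext ?_ rfl)
        ext y
        exact real_inner_smul_left v (y - x j : E) a }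
  obtain ⟨V, hV⟩ := exists_inner_eq (LinearMap.toContinuousLinearMap b)
  refine ⟨h (C1.mul (C1.bump (x j : E) ρ hρ) C1.one), V, fun f => ?_⟩
  have h1 := hw.apply_bump_mul_eq_zero hp hκ hρ hsep hpos hgr
    (f := f - (f.1.1 (x j) • C1.one + C1.affine (x j : E) (f.1.2 (x j))))
    (by
      change f.1.1 (x j) - (f.1.1 (x j) * 1 + inner ℝ (f.1.2 (x j)) (x j - x j : E)) = 0
      simp)
    (by
      change f.1.2 (x j) - (f.1.1 (x j) • (C1.one : C1 Ω).1.2 (x j) + f.1.2 (x j)) = 0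
      simp)
  rw [hV]
  change _ = _ + h (C1.mul (C1.bump (x j : E) ρ hρ) (C1.affine (x j : E) (f.1.2 (x j))))
  set f₀ := f - (f.1.1 (x j) • C1.one + C1.affine (x j : E) (f.1.2 (x j)))
  have h2 : f = f₀ + (f.1.1 (x j) • C1.one + C1.affine (x j : E) (f.1.2 (x j))) :=
    Subtype.ext (sub_add_cancel f.1 _).symm
  have h3 := congrArg (fun g => h (C1.mul (C1.bump (x j : E) ρ hρ) g)) h2
  simp only [map_add, map_smul, smul_eq_mul, h1] at h3
  linarith

end IsBoundedQuotientSeq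

end Representation

/-! ### Limit directions away from the points `x j`: measures on the contact sets -/

section Representation

variable {d : ℕ} {Ω : Compacts (EuclideanSpace ℝ (Fin d))} {N : ℕ}

local notation "E" => EuclideanSpace ℝ (Fin d)

theorem C1.mul_comm (f g : C1 Ω) : C1.mul f g = C1.mul g f :=
  Subtype.ext (Prod.ext (_root_.mul_comm f.1.1 g.1.1) (add_comm (f.1.1 • g.1.2) (g.1.1 • f.1.2)))

theorem C1.mul_one (f : C1 Ω) : C1.mul f C1.one = f := by
  refine Subtype.ext (Prod.ext ?_ ?_)
  · ext y
    simp
  · ext1 y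
    change f.1.1 y • (C1.one : C1 Ω).1.2 y + (1 : ℝ) • f.1.2 y = f.1.2 y
    simp

/-- The complement `1 - ∑ χ_j` of the cutoffs around the points `x j`. -/
def C1.complBump (x : Fin N → Ω) (ρ : ℝ) (hρ : 0 < ρ) : C1 Ω :=
  C1.one + ∑ j, (-1 : ℝ) • C1.bump (x j : E) ρ hρ

theorem C1.complBump_fst (x : Fin N → Ω) (ρ : ℝ) (hρ : 0 < ρ) (y : Ω) :
    (C1.complBump x ρ hρ).1.1 y = 1 - ∑ j, (C1.bump (x j : E) ρ hρ : C1 Ω).1.1 y * 1 := by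
  have h : (C1.complBump x ρ hρ).1.1 y
      = 1 + ∑ j, ((-1 : ℝ) • (C1.bump (x j : E) ρ hρ : C1 Ω).1.1) y := by
    simp only [C1.complBump, Submodule.coe_add, AddSubmonoidClass.coe_finsetSum, Prod.fst_add,
      Prod.fst_sum, ContinuousMap.add_apply, ContinuousMap.coe_sum, Finset.sum_apply]
    rfl
  rw [h]
  simp [sub_eq_add_neg]

theorem C1.complBump_nonneg {x : Fin N → Ω} {ρ : ℝ} (hρ : 0 < ρ) (hsep : Separated x ρ) (y : Ω) :
    0 ≤ (C1.complBump x ρ hρ).1.1 y := by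
  rw [C1.complBump_fst]
  rcases hsep.sum_bump_cases hρ y with h | ⟨j, -, h⟩ <;> rw [h]
  · simp
  · linarith [C1.bump_le_one (x j : E) ρ hρ y]

theorem C1.complBump_le_one {x : Fin N → Ω} {ρ : ℝ} (hρ : 0 < ρ) (y : Ω) :
    (C1.complBump x ρ hρ).1.1 y ≤ 1 := by
  rw [C1.complBump_fst]
  have : 0 ≤ ∑ j, (C1.bump (x j : E) ρ hρ : C1 Ω).1.1 y * 1 :=
    Finset.sum_nonneg fun j _ => mul_nonneg (C1.bump_nonneg _ _ _ _) zero_le_one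
  linarith

theorem C1.complBump_eq_zero {x : Fin N → Ω} {ρ : ℝ} (hρ : 0 < ρ) (hsep : Separated x ρ) {y : Ω}
    {j : Fin N} (hy : dist (y : E) (x j) ≤ ρ / 2) : (C1.complBump x ρ hρ).1.1 y = 0 := by
  rw [C1.complBump_fst, Finset.sum_eq_single j, C1.bump_eq_one hy]
  · simp
  · intro i _ hij
    rw [hsep.bump_eq_zero hij (hy.trans (by linarith)), zero_mul]
  · simp

theorem C1.eq_mul_complBump_add (x : Fin N → Ω) (ρ : ℝ) (hρ : 0 < ρ) (f : C1 Ω) :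
    f = C1.mul (C1.complBump x ρ hρ) f + ∑ j, C1.mul (C1.bump (x j : E) ρ hρ) f := by
  simp only [C1.mul_comm _ f]
  rw [← map_sum, ← map_add]
  conv_lhs => rw [← C1.mul_one f]
  congr 1
  rw [C1.complBump, add_assoc, ← Finset.sum_add_distrib, Finset.sum_eq_zero, add_zero]
  intro j _
  module

theorem integrable_continuousMap (μ : Measure Ω) [IsFiniteMeasure μ] (f : C(Ω, ℝ)) :
    Integrable (fun y => f y) μ :=
  BoundedContinuousFunction.integrable μ (BoundedContinuousFunction.mkOfCompact f)

namespace IsBoundedQuotientSeq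

variable {α : ℝ} {l : Fin N → ℝ} {x : Fin N → Ω} {p : C1 Ω} {M : ℝ} {t : ℕ → ℝ}
  {w : ℕ → RadonMeasure Ω} {h : NormedDual (C1 Ω)}

/-- Here `g` is not scaled with `t`, so the gap bound divided by `t` tends to zero. -/
theorem apply_nonpos (hp : IsSparsePair α l x p) (hw : IsBoundedQuotientSeq α l x p M t w h)
    {g : C1 Ω} (hg0 : ∀ j, g.1.1 (x j) = 0) (hg : ∀ y, |p.1.1 y + g.1.1 y| ≤ α) : h g ≤ 0 := by
  have hu : sparse l x g.1.1 = 0 := by simp [sparse_apply, hg0]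
  have h1 : Tendsto (fun k => M * (t k / 2)) atTop (𝓝 (M * (0 / 2))) :=
    (hw.tendsto_zero.div_const 2).const_mul M
  rw [zero_div, mul_zero] at h1
  refine le_of_tendsto_of_tendsto' (hw.tendsto_of_sparse_eq_zero hu) h1 fun k => ?_
  have h2 := hp.apply_le_of_gap (hw.gap k) le_rfl (g := g.1.1) fun y => by
    rw [add_zero]; exact hg y
  rw [div_le_iff₀ (hw.pos k)]
  linarith

/-- The factor `α + τ p` is the room available for pushing `τ p` down: for `f ≥ 0` small,
subtracting `τ ψ (α + τ p) f` from `p` keeps `|p| ≤ α`, with `ψ` the complement of the cutoffs.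
Hence the functional is positive. Test functions admissible with both signs are annihilated, which
locates the measure. -/
theorem exists_contact_measure (hp : IsSparsePair α l x p)
    (hw : IsBoundedQuotientSeq α l x p M t w h) {ρ : ℝ} (hρ : 0 < ρ) (hsep : Separated x ρ)
    {τ : ℝ} (hτ : τ = 1 ∨ τ = -1) :
    ∃ μ : Measure Ω, IsFiniteMeasure μ ∧ μ (contactSet p x (τ * α))ᶜ = 0 ∧ ∀ f : C1 Ω,
      τ * h (C1.mul (C1.mul (C1.complBump x ρ hρ) (α • C1.one + τ • p)) f) / (2 * α)
        = ∫ y, f.1.1 y ∂μ := by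
  have hα := hp.pos
  have hττ : τ * τ = 1 := by rcases hτ with rfl | rfl <;> norm_num
  have hτabs : |τ| = 1 := by rcases hτ with rfl | rfl <;> norm_num
  set ψ := C1.complBump x ρ hρ with hψ
  set q : C1 Ω := α • C1.one + τ • p with hq
  have hqy : ∀ y, q.1.1 y = α + τ * p.1.1 y := fun y => by
    change α * 1 + τ * p.1.1 y = _
    rw [_root_.mul_one]
  have hτp : ∀ y, |τ * p.1.1 y| ≤ α := fun y => by
    rw [abs_mul, hτabs, one_mul]; exact hp.abs_le y
  have habs : ∀ a b : ℝ, |a + -τ * b| = |τ * a - b| := fun a b => by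
    rcases hτ with rfl | rfl
    · congr 1; ring
    · rw [← abs_neg]; congr 1; ring
  have hψx : ∀ j, ψ.1.1 (x j) = 0 := fun j =>
    C1.complBump_eq_zero hρ hsep (j := j) (by rw [dist_self]; positivity)
  have hgapply : ∀ (a : ℝ) (f : C1 Ω) (y : Ω), (a • C1.mul (C1.mul ψ q) f).1.1 y
      = a * (ψ.1.1 y * q.1.1 y * f.1.1 y) := fun a f y => rfl
  have hgx : ∀ (a : ℝ) (f : C1 Ω) (j : Fin N), (a • C1.mul (C1.mul ψ q) f).1.1 (x j) = 0 :=
    fun a f j => by rw [hgapply, hψx]; ring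
  have hzero : ∀ {a : ℝ} {f : C1 Ω}, a ≠ 0 →
      (∀ y, |p.1.1 y + a * (ψ.1.1 y * q.1.1 y * f.1.1 y)| ≤ α) →
      (∀ y, |p.1.1 y + -a * (ψ.1.1 y * q.1.1 y * f.1.1 y)| ≤ α) →
      h (C1.mul (C1.mul ψ q) f) = 0 := by
    intro a f ha h1 h2
    have h3 := hw.apply_nonpos hp (hgx a f) h1
    have h4 := hw.apply_nonpos hp (hgx (-a) f) h2
    rw [map_smul, smul_eq_mul] at h3 h4
    have h5 : a * h (C1.mul (C1.mul ψ q) f) = 0 := by linarith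
    exact (mul_eq_zero.1 h5).resolve_left ha
  obtain ⟨μ, hμ, hint⟩ := exists_measure_of_nonneg
    ((τ / (2 * α)) • (h.toLinearMap ∘ₗ C1.mul (C1.mul ψ q))) fun f hf => by
      change 0 ≤ τ / (2 * α) * h (C1.mul (C1.mul ψ q) f)
      set c := 1 / (‖f‖ + 1) with hc
      have hcpos : 0 < c := by positivity
      have h1 := hw.apply_nonpos hp (hgx (-τ * c) f) fun y => by
        rw [hgapply, mul_assoc (-τ), habs, hqy]
        have hs0 : 0 ≤ c * (ψ.1.1 y * f.1.1 y) :=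
          mul_nonneg hcpos.le (mul_nonneg (C1.complBump_nonneg hρ hsep y) (hf y))
        have hs1 : c * (ψ.1.1 y * f.1.1 y) ≤ 1 := by
          have h2 : ψ.1.1 y * f.1.1 y ≤ ‖f‖ + 1 :=
            (mul_le_of_le_one_left (hf y) (C1.complBump_le_one hρ y)).trans
              (((le_abs_self _).trans (abs_apply_le_norm f y)).trans (by linarith))
          rw [hc, one_div_mul_eq_div]
          exact div_le_one_of_le₀ h2 (by positivity)
        have h3 : c * (ψ.1.1 y * (α + τ * p.1.1 y) * f.1.1 y)
            = c * (ψ.1.1 y * f.1.1 y) * (α + τ * p.1.1 y) := by ring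
        rw [h3]
        have h4 := abs_le.1 (hτp y)
        exact abs_le.2 ⟨by nlinarith, by nlinarith⟩
      rw [map_smul, smul_eq_mul] at h1
      have h2 : 0 ≤ c * (τ * h (C1.mul (C1.mul ψ q) f)) := by linarith
      have h3 := nonneg_of_mul_nonneg_right h2 hcpos
      rw [div_mul_eq_mul_div]
      positivity
  have hint' : ∀ f : C1 Ω, τ * h (C1.mul (C1.mul ψ q) f) / (2 * α) = ∫ y, f.1.1 y ∂μ := fun f => by
    rw [← hint f]
    change _ = τ / (2 * α) * h (C1.mul (C1.mul ψ q) f)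
    ring
  refine ⟨μ, hμ, ?_, hint'⟩
  -- Take `f = α - τ p`. Then `±ψ (α² - p²)/(2α)` is admissible, being at most `min (α - p) (α + p)`
  -- in absolute value, so the nonnegative `f` has integral zero.
  have hae1 : ∀ᵐ y ∂μ, α - τ * p.1.1 y = 0 := by
    have h1 : h (C1.mul (C1.mul ψ q) (α • C1.one + (-τ) • p)) = 0 := by
      have key : ∀ s : ℝ, |s| = 1 → ∀ y, |p.1.1 y + s * (1 / (2 * α)) * (ψ.1.1 y * q.1.1 y *
          (α • C1.one + (-τ) • p : C1 Ω).1.1 y)| ≤ α := fun s hs y => by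
        have h2 : (α • C1.one + (-τ) • p : C1 Ω).1.1 y = α - τ * p.1.1 y := by
          change α * 1 + -τ * p.1.1 y = _
          ring
        have h3 : s * (1 / (2 * α)) * (ψ.1.1 y * q.1.1 y * (α - τ * p.1.1 y))
            = s * (ψ.1.1 y * ((α - p.1.1 y) * (α + p.1.1 y) / (2 * α))) := by
          rw [hqy]
          linear_combination (-(s * ψ.1.1 y * p.1.1 y ^ 2 / (2 * α))) * hττ
        have h4 := abs_le.1 (hp.abs_le y)
        have h5 := C1.complBump_nonneg hρ hsep y
        have h6 := C1.complBump_le_one (x := x) hρ y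
        rw [← hψ] at h5 h6
        have h7 : (α - p.1.1 y) * (α + p.1.1 y) / (2 * α) ≤ α - p.1.1 y := by
          rw [div_le_iff₀ (by positivity)]
          nlinarith
        have h8 : (α - p.1.1 y) * (α + p.1.1 y) / (2 * α) ≤ α + p.1.1 y := by
          rw [div_le_iff₀ (by positivity)]
          nlinarith
        have h9 : 0 ≤ (α - p.1.1 y) * (α + p.1.1 y) / (2 * α) :=
          div_nonneg (mul_nonneg (by linarith) (by linarith)) (by positivity)
        have h10 : |s * (ψ.1.1 y * ((α - p.1.1 y) * (α + p.1.1 y) / (2 * α)))|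
            ≤ (α - p.1.1 y) * (α + p.1.1 y) / (2 * α) := by
          rw [abs_mul, hs, one_mul, abs_of_nonneg (mul_nonneg h5 h9)]
          exact mul_le_of_le_one_left h9 h6
        rw [h2, h3]
        have h11 := abs_le.1 h10
        exact abs_le.2 ⟨by linarith, by linarith⟩
      refine hzero (a := 1 / (2 * α)) (by positivity) (fun y => ?_) (fun y => ?_)
      · simpa using key 1 (by simp) y
      · simpa using key (-1) (by simp) y
    have h2 := hint' (α • C1.one + (-τ) • p)
    rw [h1, mul_zero, zero_div] at h2
    have h3 := (integral_eq_zero_iff_of_nonneg (fun y => ?_)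
      (integrable_continuousMap μ (α • C1.one + (-τ) • p : C1 Ω).1.1)).1 h2.symm
    · filter_upwards [h3] with y hy
      have hy' : α * 1 + -τ * p.1.1 y = 0 := hy
      linarith
    · change 0 ≤ α * 1 + -τ * p.1.1 y
      linarith [(abs_le.1 (hτp y)).2]
  -- A cutoff of radius `ρ/2` lives where `ψ` vanishes, so its integral is zero although it equals
  -- `1` at `x j`.
  have hae2 : ∀ j, ∀ᵐ y ∂μ, y ≠ x j := fun j => by
    have hρ2 : 0 < ρ / 2 := by positivity
    set f : C1 Ω := C1.bump (x j : E) (ρ / 2) hρ2 with hf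
    have hprod : ∀ y, ψ.1.1 y * q.1.1 y * f.1.1 y = 0 := fun y => by
      by_cases hy : dist (y : E) (x j) ≤ ρ / 2
      · rw [hψ, C1.complBump_eq_zero hρ hsep hy, zero_mul, zero_mul]
      · rw [hf, C1.bump_eq_zero (not_le.1 hy).le, mul_zero]
    have h1 : h (C1.mul (C1.mul ψ q) f) = 0 :=
      hzero one_ne_zero (fun y => by rw [hprod, mul_zero, add_zero]; exact hp.abs_le y)
        (fun y => by rw [hprod, mul_zero, add_zero]; exact hp.abs_le y)
    have h2 := hint' f
    rw [h1, mul_zero, zero_div] at h2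
    have h3 := (integral_eq_zero_iff_of_nonneg (fun y => C1.bump_nonneg _ _ _ y)
      (integrable_continuousMap μ f.1.1)).1 h2.symm
    filter_upwards [h3] with y hy hyx
    have h4 : f.1.1 y = 1 := C1.bump_eq_one (by rw [hyx, dist_self]; positivity)
    rw [h4] at hy
    exact one_ne_zero hy
  rw [← mem_ae_iff]
  filter_upwards [hae1, ae_all_iff.2 hae2] with y hy1 hy2
  refine ⟨?_, ?_⟩
  · change p.1.1 y = τ * α
    linear_combination (-τ) * hy1 - p.1.1 y * hττ
  · rintro ⟨j, rfl⟩
    exact hy2 j rfl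

theorem exists_eq_direction (hp : IsSparsePair α l x p)
    (hw : IsBoundedQuotientSeq α l x p M t w h) :
    ∃ (c : Fin N → ℝ) (V : Fin N → E) (μ ν : Measure Ω)
      (_ : IsFiniteMeasure μ) (_ : IsFiniteMeasure ν),
      μ (contactSet p x α)ᶜ = 0 ∧ ν (contactSet p x (-α))ᶜ = 0 ∧ h = direction x c V μ ν := by
  obtain ⟨κ, hκ, ρ, hρ, hsep, hgr⟩ := hp.exists_quadratic_growth
  choose c V hcV using fun j => hw.exists_local_form hp hκ hρ hsep (j := j)
    (fun y hy => (hgr j y hy).1) (fun y hy => (hgr j y hy).2)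
  obtain ⟨μ, hμ, hμc, hμi⟩ := hw.exists_contact_measure hp hρ hsep (Or.inl rfl)
  obtain ⟨ν, hν, hνc, hνi⟩ := hw.exists_contact_measure hp hρ hsep (Or.inr rfl)
  rw [one_mul] at hμc
  rw [neg_one_mul] at hνc
  refine ⟨c, V, μ, ν, hμ, hν, hμc, hνc, ContinuousLinearMap.ext fun f => ?_⟩
  rw [direction_apply, ← hμi, ← hνi]
  -- The identity `2α = (α + p) + (α - p)` splits the outer part of `h` into the two contact
  -- measures.
  have hsplit : (2 * α) • C1.mul (C1.complBump x ρ hρ) f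
      = C1.mul (C1.mul (C1.complBump x ρ hρ) (α • C1.one + (1 : ℝ) • p)) f
        + C1.mul (C1.mul (C1.complBump x ρ hρ) (α • C1.one + (-1 : ℝ) • p)) f := by
    simp only [C1.mul_comm _ f]
    rw [← map_add, ← map_add, ← map_smul]
    congr 1
    have : (α • C1.one + (1 : ℝ) • p + (α • C1.one + (-1 : ℝ) • p) : C1 Ω) = (2 * α) • C1.one := by
      module
    rw [this, map_smul, C1.mul_one]
  have h1 := congrArg h hsplit
  rw [map_smul, map_add, smul_eq_mul] at h1
  have h2 := congrArg h (C1.eq_mul_complBump_add x ρ hρ f)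
  rw [map_add, map_sum, Finset.sum_congr rfl fun j _ => hcV j f] at h2
  rw [h2]
  have hα := hp.pos
  field_simp
  linarith

end IsBoundedQuotientSeq

end Representation

/-! ### Small deformations of `Ω` that move the points `x j` -/

section Perturbation

variable {d : ℕ} {Ω : Compacts (EuclideanSpace ℝ (Fin d))} {N : ℕ}

local notation "E" => EuclideanSpace ℝ (Fin d)

open scoped Classical in
/-- The point `y + z` if it belongs to `Ω`, and `y` otherwise. -/
def translate (y : Ω) (z : E) : Ω :=
  if h : (y + z : E) ∈ (Ω : Set E) then ⟨y + z, h⟩ else y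

theorem coe_translate {y : Ω} {z : E} (h : (y + z : E) ∈ (Ω : Set E)) :
    (translate y z : E) = y + z := by
  unfold translate
  rw [dif_pos h]

/-- The balls of radius `2 ρ` around the points `x j` are contained in the interior of `Ω`. -/
def InteriorBalls (x : Fin N → Ω) (ρ : ℝ) : Prop :=
  ∀ j, Metric.ball (x j : E) (2 * ρ) ⊆ interior (Ω : Set E)

theorem exists_separated_interiorBalls {x : Fin N → Ω} (hx : Function.Injective x)
    (hx_int : ∀ j, (x j : E) ∈ interior (Ω : Set E)) :
    ∃ ρ > 0, Separated x ρ ∧ InteriorBalls x ρ := by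
  obtain ⟨ρ₀, hρ₀, hsep⟩ := exists_separated hx
  obtain ⟨ρ, hρ, h⟩ := exists_pos_le_of_finite
    (Q := fun (j : Fin N) ρ => Metric.ball (x j : E) (2 * ρ) ⊆ interior (Ω : Set E))
    (fun j => by
      obtain ⟨r, hr, hb⟩ := Metric.isOpen_iff.1 isOpen_interior _ (hx_int j)
      exact ⟨r / 2, by positivity, by rwa [mul_div_cancel₀ _ two_ne_zero]⟩)
    (fun j ρ ρ' hρ h => (Metric.ball_subset_ball (by linarith)).trans h)
  exact ⟨min ρ ρ₀, lt_min hρ hρ₀, hsep.mono (min_le_right _ _), fun j =>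
    (Metric.ball_subset_ball (by linarith [min_le_left ρ ρ₀])).trans (h j)⟩

theorem abs_sub_le_of_mem_ball {x : Fin N → Ω} {ρ : ℝ} (hball : InteriorBalls x ρ) (f : C1 Ω)
    {j : Fin N} {y z : Ω} (hy : (y : E) ∈ Metric.ball (x j : E) (2 * ρ))
    (hz : (z : E) ∈ Metric.ball (x j : E) (2 * ρ)) :
    |f.1.1 y - f.1.1 z| ≤ ‖f‖ * ‖(y - z : E)‖ := by
  have h := (convex_ball (x j : E) (2 * ρ)).norm_image_sub_le_of_norm_hasFDerivWithin_le
    (f := extendZero f.1.1) (f' := fun v => fderiv ℝ (extendZero f.1.1) v) (C := ‖f‖)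
    (fun v hv => ((C1.hasGradientAt f (x := ⟨v, interior_subset (hball j hv)⟩)
      (hball j hv)).differentiableAt.hasFDerivAt).hasFDerivWithinAt)
    (fun v hv => by
      have h1 := C1.hasGradientAt f (x := ⟨v, interior_subset (hball j hv)⟩) (hball j hv)
      rw [h1.hasFDerivAt.fderiv, LinearIsometryEquiv.norm_map]
      exact norm_snd_apply_le_norm f _) hz hy
  rwa [extendZero_coe, extendZero_coe] at h

theorem Separated.sum_bump_smul_cases {x : Fin N → Ω} {ρ : ℝ} (h : Separated x ρ) (hρ : 0 < ρ)
    (y : Ω) (a : Fin N → E) :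
    (∑ j, bump (x j : E) ρ hρ y • a j = 0) ∨
    ∃ j, dist (y : E) (x j) < ρ ∧
      ∑ i, bump (x i : E) ρ hρ y • a i = bump (x j : E) ρ hρ y • a j := by
  by_cases hy : ∃ j, (C1.bump (x j : E) ρ hρ : C1 Ω).1.1 y ≠ 0
  · obtain ⟨j, hj⟩ := hy
    have hj' := C1.dist_lt_of_bump_ne_zero hj
    refine Or.inr ⟨j, hj', Finset.sum_eq_single j (fun i _ hij => ?_) (by simp)⟩
    have h1 : bump (x i : E) ρ hρ y = 0 := h.bump_eq_zero hij hj'.le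
    rw [h1, zero_smul]
  · push Not at hy
    refine Or.inl (Finset.sum_eq_zero fun j _ => ?_)
    have h1 : bump (x j : E) ρ hρ y = 0 := hy j
    rw [h1, zero_smul]

/-- The deformation moving `x j` to `x j + a j`, the identity away from the points `x j`. -/
def deform (x : Fin N → Ω) (ρ : ℝ) (hρ : 0 < ρ) (a : Fin N → E) (y : E) : E :=
  y + ∑ j, bump (x j : E) ρ hρ y • a j

theorem deform_cases {x : Fin N → Ω} {ρ : ℝ} (hρ : 0 < ρ) (hsep : Separated x ρ)
    {a : Fin N → E} (ha : ∀ j, ‖a j‖ < ρ) (y : Ω) :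
    deform x ρ hρ a y = y ∨ ∃ j, (y : E) ∈ Metric.ball (x j : E) (2 * ρ) ∧
      deform x ρ hρ a y ∈ Metric.ball (x j : E) (2 * ρ) ∧ ‖deform x ρ hρ a y - y‖ ≤ ‖a j‖ := by
  rcases hsep.sum_bump_smul_cases hρ y a with h | ⟨j, hj, h⟩
  · left
    rw [deform, h, add_zero]
  · right
    have h1 : ‖deform x ρ hρ a y - y‖ ≤ ‖a j‖ := by
      rw [deform, add_sub_cancel_left, h, norm_smul,
        Real.norm_of_nonneg (bump (x j : E) ρ hρ).nonneg]
      exact mul_le_of_le_one_left (norm_nonneg _) (bump (x j : E) ρ hρ).le_one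
    refine ⟨j, Metric.mem_ball.2 (by linarith), Metric.mem_ball.2 ?_, h1⟩
    have h2 := dist_triangle (deform x ρ hρ a y) (y : E) (x j : E)
    rw [dist_eq_norm (deform x ρ hρ a y) (y : E)] at h2
    linarith [ha j]

theorem deform_center {x : Fin N → Ω} {ρ : ℝ} (hρ : 0 < ρ) (hsep : Separated x ρ)
    (a : Fin N → E) (j : Fin N) : deform x ρ hρ a (x j) = x j + a j := by
  have h1 : ∀ i, bump (x i : E) ρ hρ (x j) = if i = j then 1 else 0 := fun i =>
    hsep.bump_apply_center i j
  simp [deform, h1]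

theorem deform_mem {x : Fin N → Ω} {ρ : ℝ} (hρ : 0 < ρ) (hsep : Separated x ρ)
    (hball : InteriorBalls x ρ) {a : Fin N → E} (ha : ∀ j, ‖a j‖ < ρ) (y : Ω) :
    deform x ρ hρ a y ∈ (Ω : Set E) := by
  rcases deform_cases hρ hsep ha y with h | ⟨j, -, h, -⟩
  · rw [h]; exact y.2
  · exact interior_subset (hball j h)

theorem deform_mem_interior {x : Fin N → Ω} {ρ : ℝ} (hρ : 0 < ρ) (hsep : Separated x ρ)
    (hball : InteriorBalls x ρ) {a : Fin N → E} (ha : ∀ j, ‖a j‖ < ρ) {y : Ω}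
    (hy : (y : E) ∈ interior (Ω : Set E)) : deform x ρ hρ a y ∈ interior (Ω : Set E) := by
  rcases deform_cases hρ hsep ha y with h | ⟨j, -, h, -⟩
  · rwa [h]
  · exact hball j h

theorem continuous_deform (x : Fin N → Ω) (ρ : ℝ) (hρ : 0 < ρ) (a : Fin N → E) :
    Continuous (deform x ρ hρ a) :=
  continuous_id.add (continuous_finsetSum _ fun j _ =>
    (bump (x j : E) ρ hρ).continuous.smul continuous_const)

/-- Composition of a `C¹` function with a small deformation. -/
theorem exists_comp_deform {x : Fin N → Ω} {ρ : ℝ} (hρ : 0 < ρ) (hsep : Separated x ρ)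
    (hball : InteriorBalls x ρ) {a : Fin N → E} (ha : ∀ j, ‖a j‖ < ρ) (f : C1 Ω) :
    ∃ g : C1 Ω, (∀ y, |f.1.1 y - g.1.1 y| ≤ ‖f‖ * ∑ j, ‖a j‖) ∧
      (∀ j, g.1.1 (x j) = f.1.1 (translate (x j) (a j))) ∧
      (∀ j, g.1.2 (x j) = f.1.2 (translate (x j) (a j))) ∧
      ‖g‖ ≤ ‖f‖ * (1 + ∑ j, ‖a j‖ * ‖(C1.bump (x j : E) ρ hρ : C1 Ω)‖) := by
  obtain ⟨Ψ, hΨ⟩ : ∃ Ψ : C(Ω, Ω), ∀ y, (Ψ y : E) = deform x ρ hρ a y :=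
    ⟨⟨fun y => ⟨deform x ρ hρ a y, deform_mem hρ hsep hball ha y⟩,
      ((continuous_deform x ρ hρ a).comp continuous_subtype_val).subtype_mk _⟩, fun _ => rfl⟩
  -- The gradient of `f ∘ Ψ` by the chain rule. At the centers the cutoffs have zero gradient, so it
  -- reduces there to `∇f(x_j + a_j)`.
  obtain ⟨v, hv⟩ : ∃ v : C(Ω, E), ∀ y, v y = f.1.2 (Ψ y)
      + ∑ j, inner ℝ (f.1.2 (Ψ y)) (a j) • (C1.bump (x j : E) ρ hρ : C1 Ω).1.2 y :=
    ⟨⟨fun y => f.1.2 (Ψ y)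
      + ∑ j, inner ℝ (f.1.2 (Ψ y)) (a j) • (C1.bump (x j : E) ρ hρ : C1 Ω).1.2 y, by
      fun_prop⟩, fun _ => rfl⟩
  have hmem : (f.1.1.comp Ψ, v) ∈ C1 Ω := fun y hy => by
    have h1 : HasFDerivAt (deform x ρ hρ a) (ContinuousLinearMap.id ℝ E
        + ∑ j, (fderiv ℝ (bump (x j : E) ρ hρ) y).smulRight (a j)) y := by
      refine (hasFDerivAt_id (y : E)).add (HasFDerivAt.fun_sum fun j _ => ?_)
      exact (((bump (x j : E) ρ hρ).contDiff (n := 1)).differentiable one_ne_zero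
        y).hasFDerivAt.smul_const (a j)
    have h2 : HasFDerivAt (extendZero f.1.1) _ (deform x ρ hρ a y) :=
      hΨ y ▸ (C1.hasGradientAt f (x := Ψ y)
        (hΨ y ▸ deform_mem_interior hρ hsep hball ha hy)).hasFDerivAt
    have h3 := h2.comp (y : E) h1
    rw [hasGradientAt_iff_hasFDerivAt]
    refine (h3.congr_of_eventuallyEq (extendZero_eventuallyEq (fun z => ?_) hy)).congr_fderiv ?_
    · rw [Function.comp_apply, ← hΨ, extendZero_coe, ContinuousMap.comp_apply]
    · ext z
      simp only [hv, ContinuousLinearMap.comp_apply, add_apply, ContinuousLinearMap.id_apply,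
        sum_apply, ContinuousLinearMap.smulRight_apply, map_add, map_sum, map_smul, smul_apply,
        InnerProductSpace.toDual_apply_apply, smul_eq_mul, C1.bump_snd, gradient,
        LinearIsometryEquiv.apply_symm_apply]
      congr 1
      exact Finset.sum_congr rfl fun j _ => _root_.mul_comm _ _
  have hcenter : ∀ j, Ψ (x j) = translate (x j) (a j) := fun j => by
    have h1 := deform_center hρ hsep a j
    rw [← hΨ] at h1
    refine Subtype.ext (h1.trans (coe_translate ?_).symm)
    rw [← h1]
    exact (Ψ (x j)).2
  refine ⟨⟨(f.1.1.comp Ψ, v), hmem⟩, fun y => ?_, fun j => congrArg f.1.1 (hcenter j), fun j => ?_, ?_⟩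
  · change |f.1.1 y - f.1.1 (Ψ y)| ≤ _
    rcases deform_cases hρ hsep ha y with h | ⟨j, hy, hy', hle⟩
    · have h1 : Ψ y = y := Subtype.ext ((hΨ y).trans h)
      rw [h1, sub_self, abs_zero]
      positivity
    · refine (abs_sub_le_of_mem_ball hball f hy (hΨ y ▸ hy')).trans ?_
      rw [norm_sub_rev, hΨ]
      gcongr
      exact hle.trans (Finset.single_le_sum (f := fun j => ‖a j‖) (fun i _ => norm_nonneg _)
        (Finset.mem_univ j))
  · change v (x j) = _
    rw [hv, hcenter]
    simp [hsep.bump_snd_center]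
  · have hK : 0 ≤ ∑ j, ‖a j‖ * ‖(C1.bump (x j : E) ρ hρ : C1 Ω)‖ :=
      Finset.sum_nonneg fun j _ => by positivity
    have hnn : 0 ≤ ‖f‖ * (1 + ∑ j, ‖a j‖ * ‖(C1.bump (x j : E) ρ hρ : C1 Ω)‖) := by positivity
    refine max_le ((ContinuousMap.norm_le _ hnn).2 fun y => ?_)
      ((ContinuousMap.norm_le _ hnn).2 fun y => ?_)
    · refine (abs_apply_le_norm f (Ψ y)).trans ?_
      exact le_mul_of_one_le_right (norm_nonneg f) (le_add_of_nonneg_right hK)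
    · change ‖v y‖ ≤ _
      rw [hv, mul_add, _root_.mul_one, Finset.mul_sum]
      refine (norm_add_le _ _).trans (add_le_add (norm_snd_apply_le_norm f _)
        ((norm_sum_le _ _).trans (Finset.sum_le_sum fun j _ => ?_)))
      rw [norm_smul, ← mul_assoc]
      refine mul_le_mul ((norm_inner_le_norm _ _).trans ?_) (norm_snd_apply_le_norm _ _)
        (norm_nonneg _) (by positivity)
      gcongr
      exact norm_snd_apply_le_norm f _

end Perturbation

/-! ### The recovery sequence: weak* limit, norms and duality gap -/

section Recovery

variable {d : ℕ} {Ω : Compacts (EuclideanSpace ℝ (Fin d))} {N : ℕ}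

local notation "E" => EuclideanSpace ℝ (Fin d)

theorem InteriorBalls.coe_translate {x : Fin N → Ω} {ρ : ℝ} (hball : InteriorBalls x ρ)
    {j : Fin N} {z : E} (hz : ‖z‖ < 2 * ρ) : (translate (x j) z : E) = x j + z :=
  SparseLift.coe_translate (interior_subset (hball j (by simpa [Metric.mem_ball] using hz)))

theorem InteriorBalls.translate_mem_ball {x : Fin N → Ω} {ρ : ℝ} (hball : InteriorBalls x ρ)
    {j : Fin N} {z : E} (hz : ‖z‖ < 2 * ρ) :
    (translate (x j) z : E) ∈ Metric.ball (x j : E) (2 * ρ) := by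
  rw [hball.coe_translate hz]
  simpa [Metric.mem_ball] using hz

theorem InteriorBalls.exists_slope_eq {x : Fin N → Ω} {ρ : ℝ} (hball : InteriorBalls x ρ)
    (f : C1 Ω) {j : Fin N} {z : E} (hz : ‖z‖ < 2 * ρ) :
    ∃ θ ∈ Set.Ioo (0 : ℝ) 1, f.1.1 (translate (x j) z) - f.1.1 (x j)
      = inner ℝ (f.1.2 (translate (x j) (θ • z))) z := by
  have hlt : ∀ r ∈ Set.Icc (0 : ℝ) 1, ‖r • z‖ < 2 * ρ := fun r hr => by
    rw [norm_smul, Real.norm_of_nonneg hr.1]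
    exact (mul_le_of_le_one_left (norm_nonneg z) hr.2).trans_lt hz
  have hder : ∀ r ∈ Set.Icc (0 : ℝ) 1, HasDerivAt (fun r : ℝ => extendZero f.1.1 (x j + r • z))
      (inner ℝ (f.1.2 (translate (x j) (r • z))) z) r := fun r hr => by
    have h1 := (C1.hasGradientAt f (hball j (hball.translate_mem_ball (hlt r hr)))).hasFDerivAt
    rw [hball.coe_translate (hlt r hr)] at h1
    have h2 : HasDerivAt (fun r : ℝ => (x j : E) + r • z) z r := by
      simpa using ((hasDerivAt_id r).smul_const z).const_add (x j : E)
    exact h1.comp_hasDerivAt r h2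
  obtain ⟨θ, hθ, h⟩ := exists_hasDerivAt_eq_slope _ _ zero_lt_one
    (fun r hr => (hder r hr).continuousAt.continuousWithinAt)
    (fun r hr => hder r ⟨hr.1.le, hr.2.le⟩)
  refine ⟨θ, hθ, ?_⟩
  rw [h, one_smul, zero_smul, add_zero, sub_zero, div_one, ← hball.coe_translate hz,
    extendZero_coe, extendZero_coe]

theorem tendsto_smul_norm_lt (D : E) {ρ : ℝ} (hρ : 0 < ρ) :
    ∀ᶠ s : ℝ in 𝓝[>] 0, ‖s • D‖ < ρ := by
  have h : Tendsto (fun s : ℝ => ‖s • D‖) (𝓝[>] 0) (𝓝 ‖(0 : ℝ) • D‖) :=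
    ((continuous_id.smul continuous_const).norm.tendsto 0).mono_left nhdsWithin_le_nhds
  rw [zero_smul, norm_zero] at h
  exact h.eventually_lt_const hρ

theorem tendsto_slope_translate (f : C1 Ω) {y : Ω} (hy : (y : E) ∈ interior (Ω : Set E)) (D : E) :
    Tendsto (fun s : ℝ => (f.1.1 (translate y (s • D)) - f.1.1 y) / s) (𝓝[>] 0)
      (𝓝 (inner ℝ (f.1.2 y) D)) := by
  have h2 : HasDerivAt (fun r : ℝ => (y : E) + r • D) D 0 := by
    simpa using ((hasDerivAt_id (0 : ℝ)).smul_const D).const_add (y : E)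
  have h0 : (y : E) + (0 : ℝ) • D = y := by rw [zero_smul, add_zero]
  have h1 := (C1.hasGradientAt f hy).hasFDerivAt
  rw [← h0] at h1
  have h3 : HasDerivAt (extendZero f.1.1 ∘ fun r : ℝ => (y : E) + r • D)
      (InnerProductSpace.toDual ℝ E (f.1.2 y) D) 0 := h1.comp_hasDerivAt (0 : ℝ) h2
  have h4 := (hasDerivAt_iff_tendsto_slope_zero.1 h3).mono_left
    (nhdsWithin_mono 0 fun s (hs : 0 < s) => hs.ne')
  refine h4.congr' ?_
  have h5 : ∀ᶠ s : ℝ in 𝓝[>] 0, (y + s • D : E) ∈ (Ω : Set E) :=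
    nhdsWithin_le_nhds (h2.continuousAt.eventually (by
      simp only [h0]
      exact mem_nhds_of_mem_interior hy))
  filter_upwards [h5] with s hs
  simp only [Function.comp_apply, zero_add, h0]
  rw [← SparseLift.coe_translate hs, extendZero_coe,
    extendZero_coe, smul_eq_mul, inv_mul_eq_div]

theorem tendsto_translate (f : C1 Ω) {y : Ω} (hy : (y : E) ∈ interior (Ω : Set E)) (D : E) :
    Tendsto (fun s : ℝ => f.1.1 (translate y (s • D))) (𝓝[>] 0) (𝓝 (f.1.1 y)) := by
  have h1 : Tendsto (fun s : ℝ => s) (𝓝[>] 0) (𝓝 0) := tendsto_id.mono_left nhdsWithin_le_nhds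
  have h2 := (h1.mul (tendsto_slope_translate f hy D)).const_add (f.1.1 y)
  rw [zero_mul, add_zero] at h2
  refine h2.congr' ?_
  filter_upwards [self_mem_nhdsWithin] with s (hs : 0 < s)
  field_simp
  ring

theorem IsSparsePair.tendsto_second_slope {α : ℝ} {l : Fin N → ℝ} {x : Fin N → Ω} {p : C1 Ω}
    (hp : IsSparsePair α l x p) (j : Fin N) (D : E) :
    Tendsto (fun s : ℝ => (p.1.1 (translate (x j) (s • D)) - p.1.1 (x j)) / (s ^ 2 / 2)) (𝓝[>] 0)
      (𝓝 (hessian p (x j) D D)) := by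
  obtain ⟨ρ₀, hρ₀, -, hball⟩ := exists_separated_interiorBalls hp.injective hp.mem_interior
  refine Metric.tendsto_nhds.2 fun ε hε => ?_
  have hη : 0 < ε / (4 * (‖D‖ ^ 2 + 1)) := by positivity
  obtain ⟨ρ, hρ, h⟩ := hp.exists_expansion j hη
  filter_upwards [self_mem_nhdsWithin, tendsto_smul_norm_lt D hρ,
    tendsto_smul_norm_lt D (by positivity : 0 < 2 * ρ₀)] with s (hs : 0 < s) hs1 hs2
  have h1 := hball.coe_translate (j := j) hs2
  have h2 := h (translate (x j) (s • D)) (by rwa [h1, dist_eq_norm, add_sub_cancel_left])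
  rw [h1, add_sub_cancel_left] at h2
  simp only [map_smul, smul_apply, smul_eq_mul, norm_smul, Real.norm_of_nonneg hs.le] at h2
  rw [Real.dist_eq]
  have h3 : (p.1.1 (translate (x j) (s • D)) - p.1.1 (x j)) / (s ^ 2 / 2) - hessian p (x j) D D
      = (p.1.1 (translate (x j) (s • D)) - p.1.1 (x j) - s * (s * hessian p (x j) D D) / 2)
        / (s ^ 2 / 2) := by
    field_simp
  rw [h3, abs_div, abs_of_pos (by positivity : 0 < s ^ 2 / 2), div_lt_iff₀ (by positivity)]
  refine h2.trans_lt ?_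
  have h4 : ε / (4 * (‖D‖ ^ 2 + 1)) * (s * ‖D‖) ^ 2
      = ε * (s ^ 2 / 2) * (‖D‖ ^ 2 / (2 * (‖D‖ ^ 2 + 1))) := by
    field_simp
    ring
  rw [h4]
  refine mul_lt_of_lt_one_right (by positivity) ?_
  rw [div_lt_one (by positivity)]
  nlinarith [sq_nonneg ‖D‖]

/-- The measure `∑ (l_j + s c_j) δ_{x_j + s D_j} + s (μ - ν)`. -/
def perturbed (l : Fin N → ℝ) (x : Fin N → Ω) (c : Fin N → ℝ) (D : Fin N → E) (μ ν : Measure Ω)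
    [IsFiniteMeasure μ] [IsFiniteMeasure ν] (s : ℝ) : RadonMeasure Ω :=
  (∑ j, (l j + s * c j) • dirac (translate (x j) (s • D j))) + s • ofMeasure μ
    + (-s) • ofMeasure ν

/-- The difference quotient of `perturbed` in `C¹(Ω)*`. -/
def quotient (l : Fin N → ℝ) (x : Fin N → Ω) (c : Fin N → ℝ) (D : Fin N → E) (μ ν : Measure Ω)
    [IsFiniteMeasure μ] [IsFiniteMeasure ν] (s : ℝ) : NormedDual (C1 Ω) :=
  s⁻¹ • (embed (perturbed l x c D μ ν s) - embed (sparse l x))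

variable {α : ℝ} {l : Fin N → ℝ} {x : Fin N → Ω} {p : C1 Ω} {c : Fin N → ℝ}
  {D : Fin N → EuclideanSpace ℝ (Fin d)} {μ ν : Measure Ω} [IsFiniteMeasure μ] [IsFiniteMeasure ν]

theorem perturbed_apply (s : ℝ) (f : C(Ω, ℝ)) :
    perturbed l x c D μ ν s f = (∑ j, (l j + s * c j) * f (translate (x j) (s • D j)))
      + s * ∫ y, f y ∂μ - s * ∫ y, f y ∂ν := by
  simp [perturbed, sub_eq_add_neg]

theorem embed_perturbed {s : ℝ} (hs : s ≠ 0) :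
    embed (perturbed l x c D μ ν s) = embed (sparse l x) + s • quotient l x c D μ ν s := by
  rw [quotient, smul_smul, mul_inv_cancel₀ hs, one_smul, add_sub_cancel]

theorem quotient_apply {s : ℝ} (hs : s ≠ 0) (f : C1 Ω) :
    quotient l x c D μ ν s f
      = (∑ j, (l j * ((f.1.1 (translate (x j) (s • D j)) - f.1.1 (x j)) / s)
        + c j * f.1.1 (translate (x j) (s • D j))))
        + ∫ y, f.1.1 y ∂μ - ∫ y, f.1.1 y ∂ν := by
  have h1 : quotient l x c D μ ν s f
      = s⁻¹ * (perturbed l x c D μ ν s f.1.1 - sparse l x f.1.1) := by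
    rw [← embed_apply, ← embed_apply]
    rfl
  have h2 : ∑ j, (l j * ((f.1.1 (translate (x j) (s • D j)) - f.1.1 (x j)) / s)
        + c j * f.1.1 (translate (x j) (s • D j)))
      = s⁻¹ * ((∑ j, (l j + s * c j) * f.1.1 (translate (x j) (s • D j)))
        - ∑ j, l j * f.1.1 (x j)) := by
    rw [← Finset.sum_sub_distrib, Finset.mul_sum]
    refine Finset.sum_congr rfl fun j _ => ?_
    field_simp
    ring
  rw [h1, h2, perturbed_apply, sparse_apply]
  field_simp
  ring

theorem tendsto_quotient (hx : ∀ j, (x j : E) ∈ interior (Ω : Set E)) (f : C1 Ω) :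
    Tendsto (fun s => quotient l x c D μ ν s f) (𝓝[>] 0)
      (𝓝 (direction x c (fun j => l j • D j) μ ν f)) := by
  rw [direction_apply]
  have h1 : Tendsto (fun s : ℝ =>
      (∑ j, (l j * ((f.1.1 (translate (x j) (s • D j)) - f.1.1 (x j)) / s)
        + c j * f.1.1 (translate (x j) (s • D j)))) + ∫ y, f.1.1 y ∂μ - ∫ y, f.1.1 y ∂ν) (𝓝[>] 0)
      (𝓝 ((∑ j, (l j * inner ℝ (f.1.2 (x j)) (D j) + c j * f.1.1 (x j)))
        + ∫ y, f.1.1 y ∂μ - ∫ y, f.1.1 y ∂ν)) :=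
    ((tendsto_finsetSum _ fun j _ => ((tendsto_slope_translate f (hx j) (D j)).const_mul _).add
      ((tendsto_translate f (hx j) (D j)).const_mul _)).add_const _).sub_const _
  have h2 : ∀ j, l j * inner ℝ (f.1.2 (x j)) (D j) + c j * f.1.1 (x j)
      = c j * f.1.1 (x j) + inner ℝ (l j • D j) (f.1.2 (x j)) := fun j => by
    rw [real_inner_smul_left, real_inner_comm, add_comm]
  simp only [h2] at h1
  refine h1.congr' ?_
  filter_upwards [self_mem_nhdsWithin] with s (hs : 0 < s)
  rw [quotient_apply hs.ne']

theorem abs_integral_sub_le (μ : Measure Ω) [IsFiniteMeasure μ] {f g : C(Ω, ℝ)} {K : ℝ}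
    (h : ∀ y, |f y - g y| ≤ K) : |∫ y, f y ∂μ - ∫ y, g y ∂μ| ≤ K * μ.real Set.univ := by
  rw [← integral_sub (integrable_continuousMap μ f) (integrable_continuousMap μ g)]
  exact norm_integral_le_of_norm_le_const (f := fun y => f y - g y) (Eventually.of_forall h)

/-- For given `f`, the mean value theorem turns each slope at `x_j` into a gradient at an
intermediate point `x_j + a_j`. Composing `f` with the deformation sending `x_j` there yields `g`
such that the quotient at `f` is `h g` up to `O(s)‖f‖`, while `‖g‖ ≤ (1 + O(s))‖f‖`. The points
`a_j` depend on `f`, but the constants do not. -/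
theorem exists_norm_quotient_le (hx_inj : Function.Injective x)
    (hx : ∀ j, (x j : E) ∈ interior (Ω : Set E)) :
    ∃ K₁ K₂ : ℝ, ∀ᶠ s : ℝ in 𝓝[>] 0, ‖quotient l x c D μ ν s‖
      ≤ ‖direction x c (fun j => l j • D j) μ ν‖ * (1 + s * K₁) + s * K₂ := by
  obtain ⟨ρ, hρ, hsep, hball⟩ := exists_separated_interiorBalls hx_inj hx
  set h := direction x c (fun j => l j • D j) μ ν with hh
  set K₁ := ∑ j, ‖D j‖ * ‖(C1.bump (x j : E) ρ hρ : C1 Ω)‖ with hK₁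
  set L := ∑ j, ‖D j‖ with hL
  set K₂ := ∑ j, |c j| * ‖D j‖ + L * μ.real Set.univ + L * ν.real Set.univ with hK₂
  have hK₁0 : 0 ≤ K₁ := Finset.sum_nonneg fun j _ => by positivity
  have hL0 : 0 ≤ L := Finset.sum_nonneg fun j _ => by positivity
  have hC0 : 0 ≤ ∑ j, |c j| * ‖D j‖ := Finset.sum_nonneg fun j _ => by positivity
  have hK₂0 : 0 ≤ K₂ := by positivity
  refine ⟨K₁, K₂, ?_⟩
  filter_upwards [self_mem_nhdsWithin, eventually_all.2 fun j => tendsto_smul_norm_lt (D j) hρ]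
    with s (hs : 0 < s) hsD
  refine ContinuousLinearMap.opNorm_le_bound _ (by positivity) fun f => ?_
  have hsD2 : ∀ j, ‖s • D j‖ < 2 * ρ := fun j => (hsD j).trans (by linarith)
  choose θ hθ hslope using fun j => hball.exists_slope_eq f (j := j) (hsD2 j)
  set a : Fin N → E := fun j => θ j • s • D j with ha
  have hale : ∀ j, ‖a j‖ ≤ s * ‖D j‖ := fun j => by
    have h1 : ‖a j‖ = θ j * (s * ‖D j‖) := by
      rw [ha]
      simp only [norm_smul, Real.norm_of_nonneg (hθ j).1.le, Real.norm_of_nonneg hs.le]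
    rw [h1]
    exact mul_le_of_le_one_left (by positivity) (hθ j).2.le
  have halt : ∀ j, ‖a j‖ < ρ := fun j => (hale j).trans_lt (by
    have := hsD j
    rwa [norm_smul, Real.norm_of_nonneg hs.le] at this)
  obtain ⟨g, hg1, hg2, hg3, hg4⟩ := exists_comp_deform hρ hsep hball halt f
  have hsumL : ∑ j, ‖a j‖ ≤ s * L := by
    rw [hL, Finset.mul_sum]
    exact Finset.sum_le_sum fun j _ => hale j
  have hgnorm : ‖g‖ ≤ ‖f‖ * (1 + s * K₁) := by
    refine hg4.trans ?_
    gcongr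
    rw [hK₁, Finset.mul_sum]
    refine Finset.sum_le_sum fun j _ => ?_
    rw [← mul_assoc]
    exact mul_le_mul_of_nonneg_right (hale j) (by positivity)
  have hhg : |h g| ≤ ‖h‖ * (‖f‖ * (1 + s * K₁)) := h.le_of_opNorm_le_of_le le_rfl hgnorm
  -- The gradient terms cancel exactly; the remaining differences only involve values of `f` and
  -- `g`.
  have hdiff : quotient l x c D μ ν s f - h g
      = ∑ j, c j * (f.1.1 (translate (x j) (s • D j)) - f.1.1 (translate (x j) (a j)))
        + (∫ y, f.1.1 y ∂μ - ∫ y, g.1.1 y ∂μ) - (∫ y, f.1.1 y ∂ν - ∫ y, g.1.1 y ∂ν) := by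
    have h1 : ∑ j, c j * (f.1.1 (translate (x j) (s • D j)) - f.1.1 (translate (x j) (a j)))
        = (∑ j, (l j * ((f.1.1 (translate (x j) (s • D j)) - f.1.1 (x j)) / s)
          + c j * f.1.1 (translate (x j) (s • D j))))
          - ∑ j, (c j * g.1.1 (x j) + inner ℝ (l j • D j) (g.1.2 (x j))) := by
      rw [← Finset.sum_sub_distrib]
      refine Finset.sum_congr rfl fun j _ => ?_
      rw [hg2, hg3, hslope, real_inner_smul_left, real_inner_smul_right, real_inner_comm (D j)]
      change _ = l j * (s * inner ℝ (D j) (f.1.2 (translate (x j) (a j))) / s) + _ - _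
      field_simp
      ring
    rw [hh, direction_apply, quotient_apply hs.ne', h1]
    ring
  have hb1 : |∑ j, c j * (f.1.1 (translate (x j) (s • D j)) - f.1.1 (translate (x j) (a j)))|
      ≤ ‖f‖ * (s * ∑ j, |c j| * ‖D j‖) := by
    rw [Finset.mul_sum, Finset.mul_sum]
    refine (Finset.abs_sum_le_sum_abs _ _).trans (Finset.sum_le_sum fun j _ => ?_)
    have ha2 : ‖a j‖ < 2 * ρ := (halt j).trans (by linarith)
    have h1 := abs_sub_le_of_mem_ball hball f (hball.translate_mem_ball (j := j) (hsD2 j))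
      (hball.translate_mem_ball (j := j) ha2)
    rw [hball.coe_translate (hsD2 j), hball.coe_translate ha2, add_sub_add_left_eq_sub] at h1
    have h2 : ‖s • D j - a j‖ ≤ s * ‖D j‖ := by
      have h3 : s • D j - a j = ((1 - θ j) * s) • D j := by
        simp only [ha]
        module
      have h4 := (hθ j).1
      have h5 := (hθ j).2
      rw [h3, norm_smul, Real.norm_of_nonneg (mul_nonneg (by linarith) hs.le)]
      have h6 : (1 - θ j) * s ≤ s := by nlinarith
      gcongr
    rw [abs_mul]
    calc |c j| * _ ≤ |c j| * (‖f‖ * (s * ‖D j‖)) := by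
          refine mul_le_mul_of_nonneg_left (h1.trans ?_) (abs_nonneg _)
          gcongr
      _ = _ := by ring
  have hg1' : ∀ y, |f.1.1 y - g.1.1 y| ≤ ‖f‖ * (s * L) := fun y => (hg1 y).trans (by gcongr)
  have hb2 := abs_integral_sub_le μ hg1'
  have hb3 := abs_integral_sub_le ν hg1'
  rw [Real.norm_eq_abs]
  have e0 := abs_le.1 hhg
  have e1 := abs_le.1 hb1
  have e2 := abs_le.1 hb2
  have e3 := abs_le.1 hb3
  have e4 : (‖h‖ * (1 + s * K₁) + s * K₂) * ‖f‖ = ‖h‖ * (‖f‖ * (1 + s * K₁))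
      + ‖f‖ * (s * ∑ j, |c j| * ‖D j‖) + ‖f‖ * (s * L) * μ.real Set.univ
      + ‖f‖ * (s * L) * ν.real Set.univ := by
    rw [hK₂]
    ring
  rw [e4]
  exact abs_le.2 ⟨by linarith [e0.1, e1.1, e2.1, e3.2], by linarith [e0.2, e1.2, e2.2, e3.1]⟩

theorem norm_perturbed_le {s : ℝ} (hs : 0 ≤ s) :
    ‖perturbed l x c D μ ν s‖
      ≤ ∑ j, |l j + s * c j| + s * μ.real Set.univ + s * ν.real Set.univ := by
  refine (norm_add_le _ _).trans (add_le_add ((norm_add_le _ _).trans (add_le_add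
    ((norm_sum_le _ _).trans (Finset.sum_le_sum fun j _ => ?_)) ?_)) ?_)
  · rw [norm_smul, Real.norm_eq_abs]
    exact mul_le_of_le_one_right (abs_nonneg _) (norm_dirac_le _)
  · rw [norm_smul, Real.norm_of_nonneg hs]
    gcongr
    exact norm_ofMeasure_le μ
  · rw [norm_smul, norm_neg, Real.norm_of_nonneg hs]
    gcongr
    exact norm_ofMeasure_le ν

theorem integral_contactSet {μ : Measure Ω} {a : ℝ} (hμ : μ (contactSet p x a)ᶜ = 0) :
    ∫ y, p.1.1 y ∂μ = a * μ.real Set.univ := by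
  have h1 : (fun y => p.1.1 y) =ᵐ[μ] fun _ => a := by
    filter_upwards [compl_mem_ae_iff.2 hμ] with y hy
    rw [compl_compl] at hy
    exact hy.1
  rw [integral_congr_ae h1, integral_const, smul_eq_mul, _root_.mul_comm]

/-- On the contact sets `p = ±α`, so `μ` and `ν` contribute nothing to the bound. For small `s` the
coefficients `l_j + s c_j` keep their signs, and `p(x_j) = σ_j α` leaves only `-∑ (l_j + s
c_j)(p(x_j + s D_j) - p(x_j))`, which is of second order. -/
theorem IsSparsePair.tendsto_gap_bound (hp : IsSparsePair α l x p)
    (hμ : μ (contactSet p x α)ᶜ = 0) (hν : ν (contactSet p x (-α))ᶜ = 0) :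
    ∃ q : ℝ → ℝ, Tendsto q (𝓝[>] 0) (𝓝 (-∑ j, l j * hessian p (x j) (D j) (D j))) ∧
      ∀ᶠ s in 𝓝[>] 0, (α * ‖perturbed l x c D μ ν s‖ - perturbed l x c D μ ν s p.1.1)
        / (s ^ 2 / 2) ≤ q s := by
  refine ⟨fun s => -∑ j, (l j + s * c j) *
    ((p.1.1 (translate (x j) (s • D j)) - p.1.1 (x j)) / (s ^ 2 / 2)), ?_, ?_⟩
  · refine (tendsto_finsetSum _ fun j _ => Tendsto.mul ?_ (hp.tendsto_second_slope j (D j))).neg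
    have h1 : Tendsto (fun s : ℝ => l j + s * c j) (𝓝[>] 0) (𝓝 (l j + 0 * c j)) :=
      ((continuous_const.add (continuous_id.mul continuous_const)).tendsto 0).mono_left
        nhdsWithin_le_nhds
    simpa using h1
  · have hsign : ∀ j, ∀ᶠ s : ℝ in 𝓝[>] 0, |l j + s * c j| = Real.sign (l j) * (l j + s * c j) := by
      intro j
      have h1 : Tendsto (fun s : ℝ => Real.sign (l j) * (l j + s * c j)) (𝓝[>] 0)
          (𝓝 (Real.sign (l j) * (l j + 0 * c j))) :=
        ((continuous_const.mul (continuous_const.add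
          (continuous_id.mul continuous_const))).tendsto 0).mono_left nhdsWithin_le_nhds
      have h2 : 0 < Real.sign (l j) * (l j + 0 * c j) := by
        rw [zero_mul, add_zero]
        exact Real.sign_mul_pos_of_ne_zero _ (hp.ne_zero j)
      filter_upwards [h1.eventually_const_lt h2] with s hs
      rw [← abs_of_pos hs, hp.abs_sign_mul]
    filter_upwards [self_mem_nhdsWithin, eventually_all.2 hsign] with s (hs : 0 < s) hsg
    rw [div_le_iff₀ (by positivity), perturbed_apply, integral_contactSet hμ,
      integral_contactSet hν]
    have h1 := mul_le_mul_of_nonneg_left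
      (norm_perturbed_le (l := l) (x := x) (c := c) (D := D) (μ := μ) (ν := ν) hs.le) hp.pos.le
    have h2 : (-∑ j, (l j + s * c j) *
        ((p.1.1 (translate (x j) (s • D j)) - p.1.1 (x j)) / (s ^ 2 / 2))) * (s ^ 2 / 2)
        = α * ∑ j, |l j + s * c j| - ∑ j, (l j + s * c j) * p.1.1 (translate (x j) (s • D j)) := by
      rw [← Finset.sum_neg_distrib, Finset.sum_mul, Finset.mul_sum, ← Finset.sum_sub_distrib]
      refine Finset.sum_congr rfl fun j _ => ?_
      rw [hsg, hp.apply_center]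
      field_simp
      ring
    rw [h2]
    linarith

end Recovery

/-! ### The second subderivative and epi-differentiability -/

section Main

variable {d : ℕ} {Ω : Compacts (EuclideanSpace ℝ (Fin d))} {N : ℕ} {α : ℝ} {l : Fin N → ℝ}
  {x : Fin N → Ω} {p : C1 Ω}

/-- The norm in a dual space is sequentially weakly* lower semicontinuous. -/
theorem eventually_lt_norm_of_weakStarTendsto {Z : Type*} [NormedAddCommGroup Z]
    [NormedSpace ℝ Z] {h : ℕ → NormedDual Z} {h₀ : NormedDual Z} (hh : WeakStarTendsto h h₀)
    {a : ℝ} (ha : a < ‖h₀‖) : ∀ᶠ k in atTop, a < ‖h k‖ := by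
  rcases lt_or_ge a 0 with ha0 | ha0
  · exact Eventually.of_forall fun k => ha0.trans_le (norm_nonneg _)
  · obtain ⟨z, hz, hlt⟩ := ContinuousLinearMap.exists_lt_apply_of_lt_opNorm h₀ ha
    have h1 := (weakStarTendsto_iff.1 hh z).norm.eventually_const_lt hlt
    filter_upwards [h1] with k hk
    refine hk.trans_le (((h k).le_opNorm z).trans ?_)
    exact mul_le_of_le_one_right (norm_nonneg _) hz.le

theorem weakStarTendsto_const {Z : Type*} [NormedAddCommGroup Z]
    [NormedSpace ℝ Z] (h : NormedDual Z) : WeakStarTendsto (fun _ => h) h := tendsto_const_nhds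

theorem weakStarSecondSubderiv_le_liminf {Z : Type*} [NormedAddCommGroup Z]
    [NormedSpace ℝ Z] {G : NormedDual Z → EReal} {u : NormedDual Z} {z : Z} {h : NormedDual Z}
    {t : ℕ → ℝ} (ht : ∀ k, 0 < t k) (ht0 : Tendsto t atTop (𝓝 0)) {hs : ℕ → NormedDual Z}
    (hh : WeakStarTendsto hs h) : weakStarSecondSubderiv G u z h
      ≤ liminf (fun k => secondQuotient G u z (t k) (hs k)) atTop :=
  sInf_le ⟨t, hs, ht, ht0, hh, rfl⟩

namespace IsSparsePair

theorem le_weakStarSecondSubderiv (hp : IsSparsePair α l x p) {c : Fin N → ℝ}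
    {V : Fin N → EuclideanSpace ℝ (Fin d)} {μ ν : Measure Ω} [IsFiniteMeasure μ]
    [IsFiniteMeasure ν] (hμ : μ (contactSet p x α)ᶜ = 0) (hν : ν (contactSet p x (-α))ᶜ = 0) :
    ((-∑ j, 1 / l j * hessian p (x j) (V j) (V j) : ℝ) : EReal)
      ≤ weakStarSecondSubderiv (liftedNorm α) (embed (sparse l x)) p (direction x c V μ ν) := by
  refine le_sInf ?_
  rintro a ⟨t, hs, ht, ht0, hh, rfl⟩
  by_contra! hlt
  obtain ⟨M, hM1, hM2⟩ := EReal.lt_iff_exists_real_btwn.1 hlt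
  obtain ⟨t', w, hw⟩ := hp.exists_isBoundedQuotientSeq ht ht0 hh hM1
  exact absurd (hw.le_of_direction hp hμ hν) (not_le.2 (EReal.coe_lt_coe_iff.1 hM2))

theorem weakStarSecondSubderiv_eq_top (hp : IsSparsePair α l x p) {h : NormedDual (C1 Ω)}
    (hh : ¬ ∃ (c : Fin N → ℝ) (V : Fin N → EuclideanSpace ℝ (Fin d)) (μ ν : Measure Ω)
      (_ : IsFiniteMeasure μ) (_ : IsFiniteMeasure ν),
      μ (contactSet p x α)ᶜ = 0 ∧ ν (contactSet p x (-α))ᶜ = 0 ∧ h = direction x c V μ ν) :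
    weakStarSecondSubderiv (liftedNorm α) (embed (sparse l x)) p h = ⊤ := by
  refine top_le_iff.1 (le_sInf ?_)
  rintro a ⟨t, hs, ht, ht0, hht, rfl⟩
  by_contra! hlt
  obtain ⟨M, hM, -⟩ := EReal.lt_iff_exists_real_btwn.1 hlt
  obtain ⟨t', w, hw⟩ := hp.exists_isBoundedQuotientSeq ht ht0 hht hM
  exact hh (hw.exists_eq_direction hp)

/-- Moving the mass `l_j` with velocity `D_j = V_j / l_j` produces the dipole `V_j`. The upper bound
on the quotients is the computed gap; the lower bound is the one valid for every weak* convergent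
sequence. -/
theorem exists_recovery (hp : IsSparsePair α l x p) {c : Fin N → ℝ}
    {V : Fin N → EuclideanSpace ℝ (Fin d)} {μ ν : Measure Ω} [IsFiniteMeasure μ]
    [IsFiniteMeasure ν] (hμ : μ (contactSet p x α)ᶜ = 0) (hν : ν (contactSet p x (-α))ᶜ = 0)
    {t : ℕ → ℝ} (ht : ∀ k, 0 < t k) (ht0 : Tendsto t atTop (𝓝 0)) :
    ∃ hs : ℕ → NormedDual (C1 Ω), WeakStarTendsto hs (direction x c V μ ν) ∧
      Tendsto (fun k => ‖hs k‖) atTop (𝓝 ‖direction x c V μ ν‖) ∧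
      Tendsto (fun k => secondQuotient (liftedNorm α) (embed (sparse l x)) p (t k) (hs k)) atTop
        (𝓝 ((-∑ j, 1 / l j * hessian p (x j) (V j) (V j) : ℝ) : EReal)) := by
  set D : Fin N → EuclideanSpace ℝ (Fin d) := fun j => (1 / l j) • V j with hD
  have hV : (fun j => l j • D j) = V := funext fun j => by
    rw [hD, smul_smul, mul_one_div_cancel (hp.ne_zero j), one_smul]
  have ht' : Tendsto t atTop (𝓝[>] 0) :=
    tendsto_nhdsWithin_iff.2 ⟨ht0, Eventually.of_forall ht⟩
  set hs : ℕ → NormedDual (C1 Ω) := fun k => quotient l x c D μ ν (t k) with hhs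
  have hweak : WeakStarTendsto hs (direction x c V μ ν) := by
    refine weakStarTendsto_iff.2 fun f => ?_
    have h1 := (tendsto_quotient (l := l) (c := c) (D := D) (μ := μ) (ν := ν)
      hp.mem_interior f).comp ht'
    rw [hV] at h1
    exact h1
  refine ⟨hs, hweak, ?_, ?_⟩
  · obtain ⟨K₁, K₂, hK⟩ := exists_norm_quotient_le (l := l) (c := c) (D := D) (μ := μ) (ν := ν)
      hp.injective hp.mem_interior
    rw [hV] at hK
    have h1 : Tendsto (fun k => ‖direction x c V μ ν‖ * (1 + t k * K₁) + t k * K₂) atTop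
        (𝓝 (‖direction x c V μ ν‖ * (1 + 0 * K₁) + 0 * K₂)) :=
      (((ht0.mul_const K₁).const_add 1).const_mul _).add (ht0.mul_const K₂)
    rw [zero_mul, zero_mul, add_zero, add_zero, _root_.mul_one] at h1
    refine tendsto_order.2 ⟨fun a ha => eventually_lt_norm_of_weakStarTendsto hweak ha,
      fun a ha => ?_⟩
    filter_upwards [ht'.eventually hK, h1.eventually_lt_const ha] with k hk1 hk2
    exact hk1.trans_lt hk2
  · obtain ⟨q, hq, hle⟩ := hp.tendsto_gap_bound (c := c) (D := D) hμ hν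
    have hval : -∑ j, l j * hessian p (x j) (D j) (D j)
        = -∑ j, 1 / l j * hessian p (x j) (V j) (V j) := by
      congr 1
      refine Finset.sum_congr rfl fun j _ => ?_
      have := hp.ne_zero j
      simp only [hD, map_smul, smul_apply, smul_eq_mul]
      field_simp
    rw [hval] at hq
    have hq' : Tendsto (fun k => (q (t k) : EReal)) atTop
        (𝓝 ((-∑ j, 1 / l j * hessian p (x j) (V j) (V j) : ℝ) : EReal)) :=
      (continuous_coe_real_ereal.tendsto _).comp (hq.comp ht')
    refine tendsto_of_le_liminf_of_limsup_le ((hp.le_weakStarSecondSubderiv hμ hν).trans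
      (weakStarSecondSubderiv_le_liminf ht ht0 hweak)) ?_
    rw [← hq'.limsup_eq]
    refine limsup_le_limsup ?_
    filter_upwards [ht'.eventually hle] with k hk
    exact (hp.secondQuotient_le (ht k) (embed_perturbed (ht k).ne')).trans
      (EReal.coe_le_coe_iff.2 hk)

theorem weakStarSecondSubderiv_eq (hp : IsSparsePair α l x p) {c : Fin N → ℝ}
    {V : Fin N → EuclideanSpace ℝ (Fin d)} {μ ν : Measure Ω} [IsFiniteMeasure μ]
    [IsFiniteMeasure ν] (hμ : μ (contactSet p x α)ᶜ = 0) (hν : ν (contactSet p x (-α))ᶜ = 0) :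
    weakStarSecondSubderiv (liftedNorm α) (embed (sparse l x)) p (direction x c V μ ν)
      = ((-∑ j, 1 / l j * hessian p (x j) (V j) (V j) : ℝ) : EReal) := by
  have ht : ∀ k : ℕ, (0 : ℝ) < 1 / ((k : ℝ) + 1) := fun k => by positivity
  have ht0 : Tendsto (fun k : ℕ => 1 / ((k : ℝ) + 1)) atTop (𝓝 0) :=
    tendsto_one_div_add_atTop_nhds_zero_nat
  obtain ⟨hs, hweak, -, hlim⟩ := hp.exists_recovery (c := c) (V := V) hμ hν ht ht0
  refine le_antisymm ?_ (hp.le_weakStarSecondSubderiv hμ hν)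
  rw [← hlim.liminf_eq]
  exact weakStarSecondSubderiv_le_liminf ht ht0 hweak

theorem isTwiceWeakStarEpiDifferentiable (hp : IsSparsePair α l x p) :
    IsTwiceWeakStarEpiDifferentiable (liftedNorm α) (embed (sparse l x)) p := by
  intro h t ht ht0
  by_cases hh : ∃ (c : Fin N → ℝ) (V : Fin N → EuclideanSpace ℝ (Fin d)) (μ ν : Measure Ω)
      (_ : IsFiniteMeasure μ) (_ : IsFiniteMeasure ν),
      μ (contactSet p x α)ᶜ = 0 ∧ ν (contactSet p x (-α))ᶜ = 0 ∧ h = direction x c V μ ν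
  · obtain ⟨c, V, μ, ν, _, _, hμ, hν, rfl⟩ := hh
    obtain ⟨hs, h1, h2, h3⟩ := hp.exists_recovery (c := c) (V := V) hμ hν ht ht0
    exact ⟨hs, h1, h2, by rwa [hp.weakStarSecondSubderiv_eq hμ hν]⟩
  -- The second subderivative is `⊤`, so it forces the quotients to `⊤` along any admissible
  -- sequence, in particular the constant one.
  · refine ⟨fun _ => h, weakStarTendsto_const h, tendsto_const_nhds, ?_⟩
    have htop := hp.weakStarSecondSubderiv_eq_top hh
    have h1 := weakStarSecondSubderiv_le_liminf (G := liftedNorm α) (u := embed (sparse l x))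
      (z := p) ht ht0 (weakStarTendsto_const h)
    refine tendsto_of_le_liminf_of_limsup_le h1 ?_
    rw [htop]
    exact le_top

end IsSparsePair

end Main

end SparseLift

end

open SparseLift in
theorem theorem6p6 {d : ℕ} (hd : 0 < d)
    (Ω : Compacts (EuclideanSpace ℝ (Fin d)))
    (hΩ : closure (interior (Ω : Set (EuclideanSpace ℝ (Fin d)))) = Ω)
    (hquasi : UniformlyLocallyQuasiconvex (interior (Ω : Set (EuclideanSpace ℝ (Fin d)))))
    (α : ℝ) (hα : 0 < α)
    -- the measure `u = ∑ l_j δ_{x_j}` with pairwise distinct interior points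
    (N : ℕ) (l : Fin N → ℝ) (hl : ∀ j, l j ≠ 0)
    (x : Fin N → Ω) (hx_inj : Function.Injective x)
    (hx_int : ∀ j, (x j : EuclideanSpace ℝ (Fin d)) ∈
      interior (Ω : Set (EuclideanSpace ℝ (Fin d))))
    (u : RadonMeasure Ω) (hu : u = ∑ j, l j • dirac (x j))
    -- the dual variable, a `C¹` function in the subdifferential of `α ‖·‖` at `u`
    (p : C1 Ω) (hp : IsSubgradientAt (fun v : RadonMeasure Ω => α * ‖v‖) u p.1.1)
    -- it is twice differentiable at the points `x_j` and satisfies the curvature condition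
    (hp_diff : ∀ j, DifferentiableAt ℝ (fderiv ℝ (extendZero p.1.1)) (x j))
    (hp_curv : ∃ θ : ℝ, 0 < θ ∧ ∀ (j : Fin N) (v : EuclideanSpace ℝ (Fin d)),
      Real.sign (p.1.1 (x j)) * hessian p (x j) v v ≤ -θ * ‖v‖ ^ 2) :
    IsTwiceWeakStarEpiDifferentiable (liftedNorm α) (embed u) p ∧
    (∀ (c : Fin N → ℝ) (V : Fin N → EuclideanSpace ℝ (Fin d)) (μ ν : Measure Ω)
      [IsFiniteMeasure μ] [IsFiniteMeasure ν],
      μ (contactSet p x α)ᶜ = 0 → ν (contactSet p x (-α))ᶜ = 0 →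
      weakStarSecondSubderiv (liftedNorm α) (embed u) p (direction x c V μ ν) =
        ((-∑ j, 1 / l j * hessian p (x j) (V j) (V j) : ℝ) : EReal)) ∧
    (∀ h : NormedDual (C1 Ω),
      (¬ ∃ (c : Fin N → ℝ) (V : Fin N → EuclideanSpace ℝ (Fin d)) (μ ν : Measure Ω)
        (_ : IsFiniteMeasure μ) (_ : IsFiniteMeasure ν),
        μ (contactSet p x α)ᶜ = 0 ∧ ν (contactSet p x (-α))ᶜ = 0 ∧ h = direction x c V μ ν) →
      weakStarSecondSubderiv (liftedNorm α) (embed u) p h = ⊤) := by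
  subst hu
  have h := isSparsePair_of_isSubgradientAt hα hl hx_inj hx_int hp hp_diff hp_curv
  exact ⟨h.isTwiceWeakStarEpiDifferentiable,
    fun c V μ ν _ _ hμ hν => h.weakStarSecondSubderiv_eq hμ hν,
    fun g hg => h.weakStarSecondSubderiv_eq_top hg⟩
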